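/- Let $K$ be a field and $Q$ a finite quiver with vertex set $I$. Let $\overline Q$ be its double, obtained by adding a reverse arrow $a^*:j\to i$ for each arrow $a:i\to j$ of $Q$; put $(a^*)^*=a$, and $\epsilon(a)=1$ if $a$ is an arrow of $Q$, $\epsilon(a)=-1$ otherwise. Write $t(a)$ and $h(a)$ for the tail and head of $a$. For a weight $\lambda\in K^I$ let $$\Pi^\lambda=K\overline Q\Big/\Big(\sum_{a\in\overline Q_1}\epsilon(a)\,aa^*-\sum_{j\in I}\lambda_je_j\Big)$$ be the deformed preprojective algebra, and let $\operatorname{Mod}\Pi^\lambda$ be the category of left $\Pi^\lambda$-modules. Via $M\mapsto (e_jM)_j$ it is identified with the category of representations $V=(V_j,V_a)$ of $\overline Q$ with $\sum_{h(a)=j}\epsilon(a)V_aV_{a^*}=\lambda_j\,\mathrm{id}_{V_j}$ for all $j\in I$. Let $i$ be a loop-free vertex (there is no arrow from $i$ to $i$), and let $(r_i\lambda)_j=\lambda_j-(\epsilon_i,\epsilon_j)\lambda_i$, where $(\alpha,\beta)=\langle\alpha,\beta\rangle+\langle\beta,\alpha\rangle$, $\langle\alpha,\beta\rangle=\sum_{j}\alpha_j\beta_j-\sum_{a\in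 Q_1}\alpha_{t(a)}\beta_{h(a)}$ and $\epsilon_j\in\mathbb Z^I$ are the coordinate vectors; then $r_ir_i\lambda=\lambda$. For a representation $V$ of $\Pi^\lambda$ let $V_\oplus=\bigoplus_{a\in\overline Q_1,\,h(a)=i}V_{t(a)}$ with canonical injections $\mu_a:V_{t(a)}\to V_\oplus$ and projections $\pi_a:V_\oplus\to V_{t(a)}$, and let $$\mu=\sum_{h(a)=i}\mu_aV_{a^*}:V_i\to V_\oplus,\qquad \pi=\sum_{h(a)=i}\epsilon(a)V_a\pi_a:V_\oplus\to V_i ,$$ so that $\pi\mu=\lambda_i\,\mathrm{id}$. The following constructions, with the evident action on morphisms, define functors $\operatorname{Mod}\Pi^\lambda\to\operatorname{Mod}\Pi^{r_i\lambda}$. In each of them $V_j$ for $j\ne i$ and $V_a$ for $h(a)\neq i\neq t(a)$ are kept. * The cokernel reflection functor $C_i^\lambda$: $C_i^\lambda(V)_i=\operatorname{Coker}\mu$, with canonical map $c:V_\oplus\to\operatorname{Coker}\mu$, and $\gamma:\operatorname{Coker}\mu\to V_\oplus$ the map with $\gamma c=\mu\pi-\lambda_i\,\mathrm{id}$; $C_i^\lambda(V)_a=\epsilon(a)c\mu_a$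 if $h(a)=i$, and $C_i^\lambda(V)_a=\pi_{a^*}\gamma$ if $t(a)=i$. * The kernel reflection functor $K_i^\lambda$: $K_i^\lambda(V)_i=\operatorname{Ker}\pi$, with inclusion $\iota$ into $V_\oplus$, and $\gamma:V_\oplus\to\operatorname{Ker}\pi$ the map with $\iota\gamma=\mu\pi-\lambda_i\,\mathrm{id}$; $K_i^\lambda(V)_a=\epsilon(a)\gamma\mu_a$ if $h(a)=i$, and $K_i^\lambda(V)_a=\pi_{a^*}\iota$ if $t(a)=i$. * If $\lambda_i\neq0$, the Crawley-Boevey–Holland reflection functor $E_i$: $E_i(V)_i$ is the image of the idempotent $1-\lambda_i^{-1}\mu\pi$ of $V_\oplus$; $E_i(V)_a=-\epsilon(a)\lambda_i(1-\lambda_i^{-1}\mu\pi)\mu_a$ if $h(a)=i$, and $E_i(V)_a$ is the restriction of $\pi_{a^*}$ if $t(a)=i$. If $\lambda_i=0$ (so that $r_i\lambda=\lambda$), let $S_i$ be the simple $\Pi^\lambda$-module with $K$ at the vertex $i$ and zero at the other vertices, on which all arrows act as zero, and let $I_i\subseteq\Pi^\lambda$ be its annihilator, a two-sided ideal. Then: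 1. $C_i^\lambda$ is left adjoint to $K_i^{r_i\lambda}$. 2. If $\lambda_i\neq0$, then $C_i^\lambda\cong K_i^\lambda\cong E_i$, and $C_i^\lambda$ is an equivalence of categories with $C_i^{r_i\lambda}C_i^\lambda\cong\mathrm{id}_{\operatorname{Mod}\Pi^\lambda}$. 3. If $\lambda_i=0$, then $C_i^\lambda\cong I_i\otimes_{\Pi^\lambda}(-)$ and $K_i^\lambda\cong\operatorname{Hom}_{\Pi^\lambda}(I_i,-)$. -/

import Mathlib

open CategoryTheory

universe u

noncomputable section DPADefinitions

namespace DeformedPreprojective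

set_option linter.unusedSectionVars false

/-- The arrows `i → j` of the double of a quiver: the arrows `i → j` of the quiver, and a reverse
arrow for each arrow `j → i`. (`a : i ⟶ j` has tail `i` and head `j`.) -/
abbrev DArrow {I : Type u} [Quiver.{u} I] (i j : I) : Type u := (i ⟶ j) ⊕ (j ⟶ i)

/-- The involution `a ↦ a*` on the arrows of the double. -/
abbrev DArrow.star {I : Type u} [Quiver.{u} I] {i j : I} (a : DArrow i j) : DArrow j i := Sum.swap a

/-- The sign `ε(a)`: `1` on the arrows of the quiver, `-1` on the reverse arrows. -/
def eps (K : Type u) [Field K] {I : Type u} [Quiver.{u} I] {i j : I} (a : DArrow i j) : K :=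
  Sum.elim (fun _ => 1) (fun _ => -1) a

/-- Paths in the double, from `i` to the index vertex; `cons p a` is 'first `p`, then `a`'. -/
inductive DPath {I : Type u} [Quiver.{u} I] (i : I) : I → Type u
  | nil : DPath i i
  | cons {j k : I} (p : DPath i j) (a : DArrow j k) : DPath i k

namespace DPath
variable {I : Type u} [Quiver.{u} I]

/-- `p.comp q` is 'first `p`, then `q`'. -/
def comp {i j : I} (p : DPath i j) : {k : I} → DPath j k → DPath i k
  | _, nil => p
  | _, cons q a => cons (p.comp q) a

theorem nil_comp {i j : I} (p : DPath i j) : (nil : DPath i i).comp p = p := by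
  induction p with
  | nil => rfl
  | cons p a ih => rw [comp, ih]

theorem comp_assoc {i j k l : I} (p : DPath i j) (q : DPath j k) (r : DPath k l) :
    (p.comp q).comp r = p.comp (q.comp r) := by
  induction r with
  | nil => rfl
  | cons r a ih => rw [comp, comp, comp, ih]

end DPath

section
variable (K : Type u) [Field K] (I : Type u) [Quiver.{u} I]

/-- Paths with arbitrary end points. -/
abbrev AnyPath : Type u := Σ i j : I, DPath i j

/-- The path algebra of the double: the vector space with basis all paths. -/
def PathAlgebra : Type u := AnyPath I →₀ K

instance : AddCommGroup (PathAlgebra K I) := inferInstanceAs (AddCommGroup (AnyPath I →₀ K))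
instance : Module K (PathAlgebra K I) := inferInstanceAs (Module K (AnyPath I →₀ K))

variable {I}
/-- A path as an element of the path algebra. -/
def ofPath {i j : I} (p : DPath i j) : PathAlgebra K I := Finsupp.single ⟨i, j, p⟩ 1

/-- The linear map given by its values on paths. -/
def liftLin {M : Type*} [AddCommGroup M] [Module K M] (φ : ∀ {i j : I}, DPath i j → M) :
    PathAlgebra K I →ₗ[K] M :=
  Finsupp.lift M K (AnyPath I) fun p => φ p.2.2

theorem liftLin_ofPath {M : Type*} [AddCommGroup M] [Module K M] (φ : ∀ {i j : I}, DPath i j → M)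
    {i j : I} (p : DPath i j) : liftLin K φ (ofPath K p) = φ p := by
  unfold liftLin ofPath
  erw [Finsupp.lift_apply, Finsupp.sum_single_index] <;> simp

theorem lin_ext {M : Type*} [AddCommGroup M] [Module K M] {f g : PathAlgebra K I →ₗ[K] M}
    (h : ∀ (i j : I) (p : DPath i j), f (ofPath K p) = g (ofPath K p)) : f = g := by
  refine Finsupp.lhom_ext' fun ⟨i, j, p⟩ => LinearMap.ext_ring ?_
  exact h i j p

variable [DecidableEq I]

/-- The product `q p` of two paths in the path algebra: the path 'first `p`, then `q`' if `p` ends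
where `q` starts, and `0` otherwise. -/
def pathMul {i j j' k : I} (q : DPath j' k) (p : DPath i j) : PathAlgebra K I :=
  if h : j = j' then ofPath K ((h ▸ p : DPath i j').comp q) else 0

instance : Mul (PathAlgebra K I) :=
  ⟨fun x y => liftLin K (fun q => liftLin K (fun p => pathMul K q p)) x y⟩

theorem pa_mul_def (x y : PathAlgebra K I) :
  x * y = liftLin K (fun q => liftLin K (fun p => pathMul K q p)) x y := rfl

theorem ofPath_mul_eq {i j j' k : I} (q : DPath j' k) (p : DPath i j) :
    ofPath K q * ofPath K p = pathMul K q p := by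
  rw [pa_mul_def, liftLin_ofPath, liftLin_ofPath]

theorem ofPath_mul_ofPath {i j k : I} (q : DPath j k) (p : DPath i j) :
    ofPath K q * ofPath K p = ofPath K (p.comp q) := by
  simp [ofPath_mul_eq, pathMul]

theorem ofPath_mul_ofPath_of_ne {i j j' k : I} (q : DPath j' k) (p : DPath i j) (h : j ≠ j') :
    ofPath K q * ofPath K p = 0 := by
  simp [ofPath_mul_eq, pathMul, h]

instance : NonUnitalNonAssocRing (PathAlgebra K I) where
  left_distrib x y z := by simp [pa_mul_def]
  right_distrib x y z := by simp [pa_mul_def]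
  zero_mul x := by simp [pa_mul_def]
  mul_zero x := by simp [pa_mul_def]

instance : IsScalarTower K (PathAlgebra K I) (PathAlgebra K I) :=
  ⟨fun c x y => by simp [pa_mul_def]⟩

instance : SMulCommClass K (PathAlgebra K I) (PathAlgebra K I) :=
  ⟨fun c x y => by simp [pa_mul_def]⟩

theorem pa_mul_assoc (x y z : PathAlgebra K I) : x * y * z = x * (y * z) := by
  suffices h : (LinearMap.mulRight K z).comp (LinearMap.mulRight K y) =
      LinearMap.mulRight K (y * z) from LinearMap.congr_fun h x
  refine lin_ext K fun k l r => ?_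
  suffices h : (LinearMap.mulRight K z).comp (LinearMap.mulLeft K (ofPath K r)) =
      (LinearMap.mulLeft K (ofPath K r)).comp (LinearMap.mulRight K z) from
    LinearMap.congr_fun h y
  refine lin_ext K fun j k' q => ?_
  suffices h : LinearMap.mulLeft K (ofPath K r * ofPath K q) =
      (LinearMap.mulLeft K (ofPath K r)).comp (LinearMap.mulLeft K (ofPath K q)) from
    LinearMap.congr_fun h z
  refine lin_ext K fun i j' p => ?_
  simp only [LinearMap.mulLeft_apply, LinearMap.comp_apply]
  by_cases h1 : k' = k
  · subst h1
    by_cases h2 : j' = j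
    · subst h2
      simp only [ofPath_mul_ofPath, DPath.comp_assoc]
    · rw [ofPath_mul_ofPath, ofPath_mul_ofPath_of_ne K _ _ h2, ofPath_mul_ofPath_of_ne K _ _ h2,
        mul_zero]
  · by_cases h2 : j' = j
    · subst h2
      rw [ofPath_mul_ofPath, ofPath_mul_ofPath_of_ne K _ _ h1, ofPath_mul_ofPath_of_ne K _ _ h1,
        zero_mul]
    · rw [ofPath_mul_ofPath_of_ne K _ _ h2, ofPath_mul_ofPath_of_ne K _ _ h1, zero_mul, mul_zero]

variable [Fintype I]

instance : One (PathAlgebra K I) := ⟨∑ i : I, ofPath K (DPath.nil : DPath i i)⟩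

theorem pa_one_def : (1 : PathAlgebra K I) = ∑ i : I, ofPath K (DPath.nil : DPath i i) := rfl

theorem pa_one_mul (x : PathAlgebra K I) : 1 * x = x := by
  suffices h : LinearMap.mulLeft K (1 : PathAlgebra K I) = LinearMap.id from
    LinearMap.congr_fun h x
  refine lin_ext K fun i j p => ?_
  rw [LinearMap.mulLeft_apply, pa_one_def, Finset.sum_mul, Finset.sum_eq_single j]
  · rw [ofPath_mul_ofPath]; rfl
  · intro k _ hk
    exact ofPath_mul_ofPath_of_ne K _ _ hk.symm
  · simp

theorem pa_mul_one (x : PathAlgebra K I) : x * 1 = x := by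
  suffices h : LinearMap.mulRight K (1 : PathAlgebra K I) = LinearMap.id from
    LinearMap.congr_fun h x
  refine lin_ext K fun i j p => ?_
  rw [LinearMap.mulRight_apply, pa_one_def, Finset.mul_sum, Finset.sum_eq_single i]
  · rw [ofPath_mul_ofPath, DPath.nil_comp]; rfl
  · intro k _ hk
    exact ofPath_mul_ofPath_of_ne K _ _ hk
  · simp

instance : Ring (PathAlgebra K I) :=
  { (inferInstance : NonUnitalNonAssocRing (PathAlgebra K I)) with
    mul_assoc := pa_mul_assoc K
    one_mul := pa_one_mul K
    mul_one := pa_mul_one K }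

instance : Algebra K (PathAlgebra K I) :=
  Algebra.ofModule (fun c x y => smul_mul_assoc c x y) (fun c x y => mul_smul_comm c x y)

end

section
variable {K : Type u} [Field K] {I : Type u} [Quiver.{u} I] [Fintype I] [DecidableEq I]
  [∀ i j : I, Fintype (i ⟶ j)]

/-- `ρ - ∑ λ_i e_i`, where `ρ = ∑ ε(a) a a*` over all arrows `a` of the double. -/
def rhoDef (lam : I → K) : PathAlgebra K I :=
  (∑ i : I, ∑ j : I, ∑ a : DArrow j i,
      eps K a • (ofPath K (DPath.nil.cons a) * ofPath K (DPath.nil.cons a.star))) -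
    ∑ i : I, lam i • ofPath K (DPath.nil : DPath i i)

/-- The deformed preprojective algebra of weight `lam`: the quotient of the path algebra of the
double by the two-sided ideal generated by `rhoDef lam`. -/
def DPA (lam : I → K) : Type u :=
  RingQuot (fun x y : PathAlgebra K I => x = rhoDef lam ∧ y = 0)

instance (lam : I → K) : Ring (DPA lam) := inferInstanceAs (Ring (RingQuot _))
instance (lam : I → K) : Algebra K (DPA lam) := inferInstanceAs (Algebra K (RingQuot _))

/-- The quotient map. -/
def DPA.mk (lam : I → K) : PathAlgebra K I →ₐ[K] DPA lam := RingQuot.mkAlgHom K _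

/-- The class of the trivial path at `i`. -/
def DPA.e (lam : I → K) (i : I) : DPA lam := DPA.mk lam (ofPath K (DPath.nil : DPath i i))

/-- The class of an arrow. -/
def DPA.arr (lam : I → K) {i j : I} (a : DArrow i j) : DPA lam :=
  DPA.mk lam (ofPath K (DPath.nil.cons a))

theorem DPA.sum_e (lam : I → K) : ∑ i, DPA.e lam i = 1 := by
  simp only [DPA.e]
  rw [← map_sum, ← pa_one_def, map_one]

theorem DPA.e_mul_e (lam : I → K) (i : I) : DPA.e lam i * DPA.e lam i = DPA.e lam i := by
  rw [DPA.e, ← map_mul, ofPath_mul_ofPath]; rfl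

theorem DPA.e_mul_e_of_ne (lam : I → K) {i j : I} (h : i ≠ j) :
    DPA.e lam i * DPA.e lam j = 0 := by
  rw [DPA.e, DPA.e, ← map_mul, ofPath_mul_ofPath_of_ne K _ _ h.symm, map_zero]

theorem DPA.e_mul_arr (lam : I → K) {i j : I} (a : DArrow i j) :
    DPA.e lam j * DPA.arr lam a = DPA.arr lam a := by
  rw [DPA.e, DPA.arr, ← map_mul, ofPath_mul_ofPath]; rfl

theorem DPA.arr_mul_e (lam : I → K) {i j : I} (a : DArrow i j) :
    DPA.arr lam a * DPA.e lam i = DPA.arr lam a := by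
  rw [DPA.e, DPA.arr, ← map_mul, ofPath_mul_ofPath, DPath.nil_comp]

theorem DPA.e_mul_arr_of_ne (lam : I → K) {i j k : I} (a : DArrow i j) (h : k ≠ j) :
    DPA.e lam k * DPA.arr lam a = 0 := by
  rw [DPA.e, DPA.arr, ← map_mul, ofPath_mul_ofPath_of_ne K _ _ h.symm, map_zero]

theorem DPA.relation (lam : I → K) :
    ∑ i : I, ∑ j : I, ∑ a : DArrow j i, eps K a • (DPA.arr lam a * DPA.arr lam a.star) =
      ∑ i : I, lam i • DPA.e lam i := by
  have h : DPA.mk lam (rhoDef lam) = DPA.mk lam 0 := RingQuot.mkAlgHom_rel K ⟨rfl, rfl⟩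
  rw [rhoDef, map_zero, map_sub, sub_eq_zero] at h
  simp only [map_sum, map_smul, map_mul] at h
  exact h

theorem DPA.relation_at (lam : I → K) (i : I) :
    ∑ j : I, ∑ a : DArrow j i, eps K a • (DPA.arr lam a * DPA.arr lam a.star) =
      lam i • DPA.e lam i := by
  have h := congrArg (DPA.e lam i * ·) (DPA.relation lam)
  simp only [Finset.mul_sum, mul_smul_comm, ← mul_assoc] at h
  have hl : ∑ k : I, ∑ j : I, ∑ a : DArrow j k,
      eps K a • (DPA.e lam i * DPA.arr lam a * DPA.arr lam a.star) =
      ∑ j : I, ∑ a : DArrow j i, eps K a • (DPA.e lam i * DPA.arr lam a * DPA.arr lam a.star) := by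
    refine Finset.sum_eq_single i (fun k _ hk => ?_) (by simp)
    refine Finset.sum_eq_zero fun j _ => Finset.sum_eq_zero fun a _ => ?_
    rw [DPA.e_mul_arr_of_ne lam a hk.symm, zero_mul, smul_zero]
  have hr : ∑ k : I, lam k • (DPA.e lam i * DPA.e lam k) = lam i • (DPA.e lam i * DPA.e lam i) := by
    refine Finset.sum_eq_single i (fun k _ hk => ?_) (by simp)
    rw [DPA.e_mul_e_of_ne lam hk.symm, smul_zero]
  rw [hl, hr] at h
  simpa only [DPA.e_mul_arr, DPA.e_mul_e] using h

theorem DPA.induction_on (lam : I → K) {P : DPA lam → Prop} (x : DPA lam)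
    (h_add : ∀ x y, P x → P y → P (x + y)) (h_smul : ∀ (c : K) x, P x → P (c • x))
    (h_e : ∀ i, P (DPA.e lam i))
    (h_mul : ∀ {i j : I} (a : DArrow i j) x, P x → P (DPA.arr lam a * x))
    (h_zero : P 0) : P x := by
  obtain ⟨y, rfl⟩ : ∃ y, DPA.mk lam y = x := RingQuot.mkAlgHom_surjective K _ x
  have hp : ∀ {i j : I} (p : DPath i j), P (DPA.mk lam (ofPath K p)) := by
    intro i j p
    induction p with
    | nil => exact h_e i
    | @cons j k p a ih =>
      have := h_mul a _ ih
      rwa [DPA.arr, ← map_mul, ofPath_mul_ofPath] at this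
  have key : ∀ y : PathAlgebra K I, P (DPA.mk lam y) := by
    intro y
    refine Finsupp.induction_linear y ?_ ?_ ?_
    · erw [map_zero]; exact h_zero
    · intro f g hf hg
      erw [map_add]; exact h_add _ _ hf hg
    · rintro ⟨i, j, p⟩ c
      have h1 : (Finsupp.single ⟨i, j, p⟩ c : AnyPath I →₀ K) =
          c • (Finsupp.single ⟨i, j, p⟩ 1 : AnyPath I →₀ K) := by simp
      rw [h1]
      have := h_smul c _ (hp p)
      rw [← map_smul] at this
      exact this
  exact key y

/-- Representations of the deformed preprojective algebra: vector spaces at the vertices and linear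
maps for the arrows of the double, with `∑_{h(a) = i} ε(a) V_a V_{a*} = λ_i` for each vertex `i`. -/
structure Rep (lam : I → K) where
  obj : I → Type u
  [acg : ∀ i, AddCommGroup (obj i)]
  [mod : ∀ i, Module K (obj i)]
  map : ∀ {i j : I}, DArrow i j → (obj i →ₗ[K] obj j)
  rel : ∀ i : I, ∑ j : I, ∑ a : DArrow j i, eps K a • (map a ∘ₗ map a.star) =
    lam i • (LinearMap.id : obj i →ₗ[K] obj i)

attribute [instance] Rep.acg Rep.mod

namespace Rep

variable {lam : I → K}

/-- Morphisms of representations. -/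
@[ext]
structure Hom (U V : Rep lam) where
  app : ∀ i : I, U.obj i →ₗ[K] V.obj i
  comm : ∀ {i j : I} (a : DArrow i j), app j ∘ₗ U.map a = V.map a ∘ₗ app i

instance : Category (Rep lam) where
  Hom U V := Hom U V
  id U := ⟨fun _ => LinearMap.id, fun _ => rfl⟩
  comp f g := ⟨fun i => g.app i ∘ₗ f.app i, fun a => by
    rw [LinearMap.comp_assoc, f.comm, ← LinearMap.comp_assoc, g.comm, LinearMap.comp_assoc]⟩

@[ext]
theorem hom_ext {U V : Rep lam} {f g : U ⟶ V} (h : ∀ i, f.app i = g.app i) : f = g :=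
  Hom.ext (funext h)

@[simp]
theorem id_app (U : Rep lam) (i : I) : Hom.app (𝟙 U) i = LinearMap.id := rfl

@[simp]
theorem comp_app {U V W : Rep lam} (f : U ⟶ V) (g : V ⟶ W) (i : I) :
    Hom.app (f ≫ g) i = g.app i ∘ₗ f.app i := rfl

theorem comm_apply {U V : Rep lam} (f : U ⟶ V) {i j : I} (a : DArrow i j) (x : U.obj i) :
    f.app j (U.map a x) = V.map a (f.app i x) := LinearMap.congr_fun (f.comm a) x

/-! The module with underlying space `∏ V_i` attached to a representation. -/

/-- The action of a path on a representation. -/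
def pathMap (V : Rep lam) {i : I} : {j : I} → DPath i j → (V.obj i →ₗ[K] V.obj j)
  | _, .nil => LinearMap.id
  | _, .cons p a => V.map a ∘ₗ V.pathMap p

theorem pathMap_comp (V : Rep lam) {i j k : I} (p : DPath i j) (q : DPath j k) :
    V.pathMap (p.comp q) = V.pathMap q ∘ₗ V.pathMap p := by
  induction q with
  | nil => rfl
  | cons q a ih => rw [DPath.comp, pathMap, pathMap, ih, LinearMap.comp_assoc]

/-- The space `∏ V_i` (equivalently `⨁ V_i`, there being finitely many vertices). -/
def total (V : Rep lam) : Type u := ∀ i : I, V.obj i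

instance (V : Rep lam) : AddCommGroup V.total := inferInstanceAs (AddCommGroup (∀ i, V.obj i))
instance (V : Rep lam) : Module K V.total := inferInstanceAs (Module K (∀ i, V.obj i))

/-- The inclusion of `V_i`. -/
def incl (V : Rep lam) (i : I) : V.obj i →ₗ[K] V.total := LinearMap.single K V.obj i
/-- The projection to `V_i`. -/
def proj (V : Rep lam) (i : I) : V.total →ₗ[K] V.obj i := LinearMap.proj i

theorem proj_incl (V : Rep lam) (i : I) : V.proj i ∘ₗ V.incl i = LinearMap.id := by
  ext x; exact Pi.single_eq_same i x

theorem proj_incl_of_ne (V : Rep lam) {i j : I} (h : i ≠ j) : V.proj i ∘ₗ V.incl j = 0 := by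
  ext x; exact Pi.single_eq_of_ne h x

theorem sum_incl_proj (V : Rep lam) : ∑ i, V.incl i ∘ₗ V.proj i = LinearMap.id := by
  ext x
  rw [LinearMap.sum_apply]
  exact Finset.univ_sum_single (x : ∀ i, V.obj i)

/-- The action of a path on `∏ V_i`. -/
def pathAct (V : Rep lam) {i j : I} (p : DPath i j) : Module.End K V.total :=
  V.incl j ∘ₗ V.pathMap p ∘ₗ V.proj i

theorem pathAct_mul (V : Rep lam) {i j k : I} (q : DPath j k) (p : DPath i j) :
    V.pathAct q * V.pathAct p = V.pathAct (p.comp q) := by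
  ext x
  have := LinearMap.congr_fun (V.proj_incl j) (V.pathMap p (V.proj i x))
  simp only [LinearMap.comp_apply, LinearMap.id_apply] at this
  simp [pathAct, Module.End.mul_apply, pathMap_comp, this]

theorem pathAct_mul_of_ne (V : Rep lam) {i j j' k : I} (q : DPath j' k) (p : DPath i j)
    (h : j ≠ j') : V.pathAct q * V.pathAct p = 0 := by
  ext x
  have := LinearMap.congr_fun (V.proj_incl_of_ne h.symm) (V.pathMap p (V.proj i x))
  simp only [LinearMap.comp_apply, LinearMap.zero_apply] at this
  simp [pathAct, Module.End.mul_apply, this]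

/-- The action of the path algebra on `∏ V_i`. -/
def pathAlgHom (V : Rep lam) : PathAlgebra K I →ₐ[K] Module.End K V.total :=
  AlgHom.ofLinearMap (liftLin K fun p => V.pathAct p)
    (by
      rw [pa_one_def, map_sum]
      simp only [liftLin_ofPath]
      exact V.sum_incl_proj)
    (by
      intro x y
      suffices h : (liftLin K fun p => V.pathAct p).comp (LinearMap.mulRight K y) =
          (LinearMap.mulRight K (liftLin K (fun p => V.pathAct p) y)).comp
            (liftLin K fun p => V.pathAct p) from LinearMap.congr_fun h x
      refine lin_ext K fun j' k q => ?_
      suffices h : (liftLin K fun p => V.pathAct p).comp (LinearMap.mulLeft K (ofPath K q)) =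
          (LinearMap.mulLeft K (V.pathAct q)).comp
            (liftLin K fun p => V.pathAct p) by
        have := LinearMap.congr_fun h y
        simpa [liftLin_ofPath] using this
      refine lin_ext K fun i j p => ?_
      simp only [LinearMap.comp_apply, LinearMap.mulLeft_apply, liftLin_ofPath]
      by_cases h : j = j'
      · subst h
        rw [ofPath_mul_ofPath, liftLin_ofPath, pathAct_mul]
      · rw [ofPath_mul_ofPath_of_ne K _ _ h, map_zero, pathAct_mul_of_ne V _ _ h])

theorem pathAlgHom_ofPath (V : Rep lam) {i j : I} (p : DPath i j) :
    V.pathAlgHom (ofPath K p) = V.pathAct p := liftLin_ofPath K _ p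

theorem pathAlgHom_rho (V : Rep lam) : V.pathAlgHom (rhoDef lam) = 0 := by
  rw [rhoDef, map_sub, sub_eq_zero]
  simp only [map_sum, map_smul, ofPath_mul_ofPath, pathAlgHom_ofPath]
  refine Finset.sum_congr rfl fun i _ => ?_
  have h := congrArg (fun f => V.incl i ∘ₗ f ∘ₗ V.proj i) (V.rel i)
  simp only [LinearMap.comp_smul, LinearMap.smul_comp] at h
  refine Eq.trans ?_ (h.trans rfl)
  ext x
  simp [pathAct, pathMap, DPath.comp, LinearMap.sum_apply, map_sum]

/-- The action of the deformed preprojective algebra on `∏ V_i`. -/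
def actHom (V : Rep lam) : DPA lam →ₐ[K] Module.End K V.total :=
  RingQuot.liftAlgHom K ⟨V.pathAlgHom, by
    rintro x y ⟨rfl, rfl⟩
    rw [V.pathAlgHom_rho, map_zero]⟩

theorem actHom_mk (V : Rep lam) (x : PathAlgebra K I) :
    V.actHom (DPA.mk lam x) = V.pathAlgHom x :=
  RingQuot.liftAlgHom_mkAlgHom_apply K _ _ x

theorem actHom_e (V : Rep lam) (i : I) : V.actHom (DPA.e lam i) = V.incl i ∘ₗ V.proj i := by
  rw [DPA.e, actHom_mk, pathAlgHom_ofPath]; rfl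

theorem actHom_arr (V : Rep lam) {i j : I} (a : DArrow i j) :
    V.actHom (DPA.arr lam a) = V.incl j ∘ₗ V.map a ∘ₗ V.proj i := by
  rw [DPA.arr, actHom_mk, pathAlgHom_ofPath]; rfl

instance (V : Rep lam) : Module (DPA lam) V.total := Module.compHom _ V.actHom.toRingHom

theorem smul_total (V : Rep lam) (x : DPA lam) (v : V.total) : x • v = V.actHom x v := rfl

/-- The module attached to a representation. -/
abbrev toMod (V : Rep lam) : ModuleCat.{u} (DPA lam) := ModuleCat.of _ V.total

end Rep

/-! The equivalence between modules and representations, `M ↦ (e_i M)`. -/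
section Equiv
open scoped ModuleCat
variable {lam : I → K}

/-- The subspace `e_i M`. -/
def part (M : ModuleCat.{u} (DPA lam)) (i : I) : Submodule K M :=
  LinearMap.range (Algebra.lsmul K K M (DPA.e lam i))

theorem mem_part {M : ModuleCat.{u} (DPA lam)} {i : I} {m : M} :
    m ∈ part M i ↔ DPA.e lam i • m = m := by
  constructor
  · rintro ⟨n, rfl⟩
    simp only [Algebra.lsmul_coe]
    rw [← mul_smul, DPA.e_mul_e]
  · intro h
    exact ⟨m, h⟩

theorem arr_smul_mem (M : ModuleCat.{u} (DPA lam)) {i j : I} (a : DArrow i j) (m : M) :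
    DPA.arr lam a • m ∈ part M j := by
  rw [mem_part, ← mul_smul, DPA.e_mul_arr]

/-- Multiplication by `a`, as a map `e_{t(a)} M → e_{h(a)} M`. -/
def partMap (M : ModuleCat.{u} (DPA lam)) {i j : I} (a : DArrow i j) : part M i →ₗ[K] part M j :=
  ((Algebra.lsmul K K M (DPA.arr lam a)).comp (part M i).subtype).codRestrict (part M j)
    fun m => arr_smul_mem M a m

theorem partMap_coe (M : ModuleCat.{u} (DPA lam)) {i j : I} (a : DArrow i j) (m : part M i) :
    (partMap M a m : M) = DPA.arr lam a • (m : M) := rfl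

/-- The representation `(e_i M)_i` of a module `M`. -/
def modToRepObj (M : ModuleCat.{u} (DPA lam)) : Rep lam where
  obj i := part M i
  map a := partMap M a
  rel i := by
    ext m
    have h := congrArg (· • (m : M)) (DPA.relation_at lam i)
    simp only [Finset.sum_smul, smul_assoc, mul_smul] at h
    rw [mem_part.1 m.2] at h
    simpa [LinearMap.sum_apply, partMap_coe] using h

/-- A module homomorphism restricted to `e_i M → e_i N`. -/
def homPart {M N : ModuleCat.{u} (DPA lam)} (f : M ⟶ N) (i : I) : part M i →ₗ[K] part N i :=
  LinearMap.restrict (f.hom.restrictScalars K) fun m hm => by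
    rw [mem_part] at hm ⊢
    rw [LinearMap.restrictScalars_apply, ← map_smul, hm]

theorem homPart_coe {M N : ModuleCat.{u} (DPA lam)} (f : M ⟶ N) (i : I) (m : part M i) :
    (homPart f i m : N) = f.hom (m : M) := rfl

variable (lam) in
/-- The functor from modules to representations, `M ↦ (e_i M)_i`; it is an equivalence (below). -/
def modToRep : ModuleCat.{u} (DPA lam) ⥤ Rep lam where
  obj M := modToRepObj M
  map {M N} f := ⟨fun i => homPart f i, fun {i j} a => by
    refine LinearMap.ext fun m => Subtype.ext ?_
    exact map_smul f.hom (DPA.arr lam a) (m : part M i).1⟩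
  map_id M := rfl
  map_comp f g := rfl

theorem sum_e_smul (M : ModuleCat.{u} (DPA lam)) (m : M) : ∑ i, DPA.e lam i • m = m := by
  rw [← Finset.sum_smul, DPA.sum_e, one_smul]

/-- Multiplication by `e_i`. -/
def toPart (M : ModuleCat.{u} (DPA lam)) (i : I) : M →ₗ[K] part M i :=
  (Algebra.lsmul K K M (DPA.e lam i)).rangeRestrict

theorem toPart_coe (M : ModuleCat.{u} (DPA lam)) (i : I) (m : M) :
    (toPart M i m : M) = DPA.e lam i • m := rfl

instance : (modToRep lam).Faithful where
  map_injective {M N f g} h := by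
    ext m
    rw [← sum_e_smul M m, map_sum, map_sum]
    refine Finset.sum_congr rfl fun i _ => ?_
    have := congrArg (fun k : (modToRep lam).obj M ⟶ (modToRep lam).obj N =>
      (k.app i (toPart M i m) : part N i)) h
    exact congrArg Subtype.val this

/-- A map is linear if it commutes with scalars, the `e_i` and the arrows. -/
theorem linear_of_gen {M N : Type u} [AddCommGroup M] [AddCommGroup N] [Module (DPA lam) M]
    [Module (DPA lam) N] [Module K M] [Module K N] [IsScalarTower K (DPA lam) M]
    [IsScalarTower K (DPA lam) N] (f : M →ₗ[K] N)
    (he : ∀ i m, f (DPA.e lam i • m) = DPA.e lam i • f m)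
    (ha : ∀ {i j : I} (a : DArrow i j) m, f (DPA.arr lam a • m) = DPA.arr lam a • f m)
    (x : DPA lam) : ∀ m : M, f (x • m) = x • f m := by
  refine DPA.induction_on lam (P := fun x => ∀ m : M, f (x • m) = x • f m) x ?_ ?_ ?_ ?_ ?_
  · intro x y hx hy m
    rw [add_smul, map_add, hx, hy, add_smul]
  · intro c x hx m
    rw [smul_assoc, map_smul, hx, smul_assoc]
  · intro i m
    exact he i m
  · intro i j a x hx m
    rw [mul_smul, ha, hx, mul_smul]
  · intro m
    simp

instance : (modToRep lam).Full where
  map_surjective {M N} g := by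
    let g' : ∀ i, part M i →ₗ[K] part N i := fun i => g.app i
    let f : M →ₗ[K] N := ∑ i, (part N i).subtype ∘ₗ g' i ∘ₗ toPart M i
    have hf : ∀ m, f m = ∑ i, (g' i (toPart M i m) : N) := fun m => by
      simp [f, LinearMap.sum_apply]
    have hpart : ∀ i (m : part M i), f m = g' i m := by
      intro i m
      rw [hf, Finset.sum_eq_single i]
      · congr 2
        exact Subtype.ext (mem_part.1 m.2)
      · intro j _ hj
        have : toPart M j m = 0 := by
          refine Subtype.ext ?_
          rw [toPart_coe, ← mem_part.1 m.2, ← mul_smul, DPA.e_mul_e_of_ne lam hj, zero_smul]; rfl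
        rw [this, map_zero]; rfl
      · simp
    have he : ∀ i m, f (DPA.e lam i • m) = DPA.e lam i • f m := by
      intro i m
      rw [← toPart_coe, hpart, hf, Finset.smul_sum, Finset.sum_eq_single i]
      · rw [mem_part.1 (g' i _).2]
      · intro j _ hj
        rw [← mem_part.1 (g' j _).2, ← mul_smul, DPA.e_mul_e_of_ne lam hj.symm, zero_smul]
      · simp
    have ha : ∀ {i j : I} (a : DArrow i j) m, f (DPA.arr lam a • m) = DPA.arr lam a • f m := by
      intro i j a m
      have h1 : DPA.arr lam a • m = DPA.arr lam a • DPA.e lam i • m := by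
        rw [← mul_smul, DPA.arr_mul_e]
      have h2 : DPA.arr lam a • f m = DPA.arr lam a • f (DPA.e lam i • m) := by
        rw [he, ← mul_smul, DPA.arr_mul_e]
      rw [h1, h2, ← toPart_coe, ← partMap_coe, hpart, hpart]
      exact congrArg Subtype.val (Rep.comm_apply g a (toPart M i m))
    refine ⟨ModuleCat.ofHom { f with map_smul' := linear_of_gen f he ha }, ?_⟩
    refine Rep.hom_ext fun i => LinearMap.ext fun m => Subtype.ext ?_
    exact hpart i m

theorem Rep.algebraMap_smul_total (V : Rep lam) (c : K) (v : V.total) :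
    algebraMap K (DPA lam) c • v = c • v := by
  rw [Rep.smul_total, AlgHom.commutes, Module.algebraMap_end_apply]

/-- `V_i ≅ e_i (∏ V_j)`. -/
def Rep.partEquiv (V : Rep lam) (i : I) : V.obj i ≃ₗ[K] part V.toMod i where
  toFun x := ⟨V.incl i x, mem_part.2 <| by
    change V.actHom (DPA.e lam i) (V.incl i x) = _
    rw [Rep.actHom_e]
    exact congrArg (V.incl i) (LinearMap.congr_fun (V.proj_incl i) x)⟩
  invFun y := V.proj i y.1
  map_add' x y := Subtype.ext (map_add (V.incl i) x y)
  map_smul' c x := Subtype.ext <| by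
    refine (map_smul (V.incl i) c x).trans ?_
    exact (V.algebraMap_smul_total c (V.incl i x)).symm
  left_inv x := LinearMap.congr_fun (V.proj_incl i) x
  right_inv y := Subtype.ext <| by
    have := mem_part.1 y.2
    change V.actHom (DPA.e lam i) y.1 = _ at this
    rwa [Rep.actHom_e] at this

theorem Rep.partEquiv_comm (V : Rep lam) {i j : I} (a : DArrow i j) (x : V.obj i) :
    V.partEquiv j (V.map a x) = partMap V.toMod a (V.partEquiv i x) := by
  refine Subtype.ext ?_
  change V.incl j (V.map a x) = V.actHom (DPA.arr lam a) (V.incl i x)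
  rw [Rep.actHom_arr]
  have := LinearMap.congr_fun (V.proj_incl i) x
  simp only [LinearMap.comp_apply, LinearMap.id_apply] at this ⊢
  rw [this]

/-- Every representation comes from a module. -/
def Rep.isoToMod (V : Rep lam) : V ≅ (modToRep lam).obj V.toMod where
  hom := ⟨fun i => (V.partEquiv i).toLinearMap, fun a => LinearMap.ext (V.partEquiv_comm a)⟩
  inv := ⟨fun i => (V.partEquiv i).symm.toLinearMap, fun {i j} a => LinearMap.ext fun y => by
    obtain ⟨x, rfl⟩ := (V.partEquiv i).surjective y
    have h := V.partEquiv_comm a x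
    change (V.partEquiv j).symm (partMap V.toMod a (V.partEquiv i x)) =
      V.map a ((V.partEquiv i).symm (V.partEquiv i x))
    rw [← h, LinearEquiv.symm_apply_apply, LinearEquiv.symm_apply_apply]⟩
  hom_inv_id := Rep.hom_ext fun i => LinearMap.ext fun x => (V.partEquiv i).symm_apply_apply x
  inv_hom_id := Rep.hom_ext fun i => LinearMap.ext fun x => (V.partEquiv i).apply_symm_apply x

instance : (modToRep lam).EssSurj := ⟨fun V => ⟨V.toMod, ⟨V.isoToMod.symm⟩⟩⟩

instance : (modToRep lam).IsEquivalence where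

end Equiv


/-! Reflections of weights. -/

section Reflection

/-- The Ringel form of the quiver. -/
def ringelForm (α β : I → ℤ) : ℤ :=
  ∑ i : I, α i * β i - ∑ i : I, ∑ j : I, ∑ _a : (i ⟶ j), α i * β j

/-- The symmetric bilinear form `(α, β)`. -/
def symForm (α β : I → ℤ) : ℤ := ringelForm α β + ringelForm β α

/-- The reflection `r_i` on weights: `(r_i λ)_j = λ_j - (ε_i, ε_j) λ_i`. -/
def reflWeight (i : I) (lam : I → K) : I → K := fun j =>
  lam j - (symForm (Pi.single i 1 : I → ℤ) (Pi.single j 1) : K) * lam i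

/-- There are no loops at `i`. -/
def LoopFree (i : I) : Prop := IsEmpty (i ⟶ i)

theorem ringelForm_single (i j : I) :
    ringelForm (Pi.single i 1 : I → ℤ) (Pi.single j 1) =
      (if i = j then 1 else 0) - (Fintype.card (i ⟶ j) : ℤ) := by
  have h1 : ∑ k : I, (Pi.single i 1 : I → ℤ) k * (Pi.single j 1 : I → ℤ) k =
      if i = j then 1 else 0 := by
    rw [Finset.sum_eq_single i (fun k _ hk => by rw [Pi.single_eq_of_ne hk, zero_mul]) (by simp)]
    by_cases h : i = j
    · subst h; simp
    · simp [h]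
  have h2 : ∑ k : I, ∑ l : I, ∑ _a : (k ⟶ l), (Pi.single i 1 : I → ℤ) k * (Pi.single j 1 : I → ℤ) l =
      (Fintype.card (i ⟶ j) : ℤ) := by
    rw [Finset.sum_eq_single i (fun k _ hk => by simp [Pi.single_eq_of_ne hk]) (by simp),
      Finset.sum_eq_single j (fun k _ hk => by simp [Pi.single_eq_of_ne hk]) (by simp)]
    simp
  rw [ringelForm, h1, h2]

theorem reflWeight_self {i : I} (hi : LoopFree i) (lam : I → K) :
    reflWeight i lam i = -lam i := by
  have : Fintype.card (i ⟶ i) = 0 := Fintype.card_eq_zero_iff.2 hi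
  rw [reflWeight, symForm, ringelForm_single, this]
  simp
  ring

theorem reflWeight_of_ne {i j : I} (h : j ≠ i) (lam : I → K) :
    reflWeight i lam j = lam j + (Fintype.card (DArrow i j) : K) * lam i := by
  rw [reflWeight, symForm, ringelForm_single, ringelForm_single, Fintype.card_sum]
  simp [h, h.symm]
  ring

theorem reflWeight_reflWeight {i : I} (hi : LoopFree i) (lam : I → K) :
    reflWeight i (reflWeight i lam) = lam := by
  funext j
  by_cases h : j = i
  · subst h; rw [reflWeight_self hi, reflWeight_self hi, neg_neg]
  · rw [reflWeight_of_ne h, reflWeight_of_ne h, reflWeight_self hi]; ring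

theorem reflWeight_eq_self {i : I} {lam : I → K} (h : lam i = 0) : reflWeight i lam = lam := by
  funext j
  simp [reflWeight, h]

namespace Rep

variable {lam lam' : I → K}

/-- `V_⊕ = ⨁_{h(a) = i} V_{t(a)}`, over the arrows `a` of the double with head `i`. -/
abbrev Oplus (V : Rep lam) (i : I) : Type u := ∀ a : (Σ j : I, DArrow j i), V.obj a.1

open Classical in
/-- The canonical injection `μ_a : V_{t(a)} → V_⊕`. -/
def inj (V : Rep lam) {i j : I} (a : DArrow j i) : V.obj j →ₗ[K] V.Oplus i :=
  LinearMap.single K (fun a : (Σ j : I, DArrow j i) => V.obj a.1) ⟨j, a⟩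

/-- The canonical surjection `π_a : V_⊕ → V_{t(a)}`. -/
def prj (V : Rep lam) {i j : I} (a : DArrow j i) : V.Oplus i →ₗ[K] V.obj j :=
  LinearMap.proj (φ := fun a : (Σ j : I, DArrow j i) => V.obj a.1) ⟨j, a⟩

/-- `μ = ∑_{h(a) = i} μ_a V_{a*} : V_i → V_⊕`. -/
def mu (V : Rep lam) (i : I) : V.obj i →ₗ[K] V.Oplus i :=
  ∑ j : I, ∑ a : DArrow j i, V.inj a ∘ₗ V.map a.star

/-- `π = ∑_{h(a) = i} ε(a) V_a π_a : V_⊕ → V_i`. -/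
def pi (V : Rep lam) (i : I) : V.Oplus i →ₗ[K] V.obj i :=
  ∑ j : I, ∑ a : DArrow j i, eps K a • (V.map a ∘ₗ V.prj a)

/-- `μ π - λ_i : V_⊕ → V_⊕`. -/
def theta (V : Rep lam) (i : I) : V.Oplus i →ₗ[K] V.Oplus i :=
  V.mu i ∘ₗ V.pi i - lam i • LinearMap.id

theorem prj_inj (V : Rep lam) {i j : I} (a : DArrow j i) : V.prj a ∘ₗ V.inj a = LinearMap.id := by
  ext x
  simp [prj, inj]

theorem sum_inj_prj (V : Rep lam) (i : I) :
    ∑ j : I, ∑ a : DArrow j i, V.inj a ∘ₗ V.prj a = LinearMap.id := by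
  classical
  refine LinearMap.ext fun x => ?_
  have h := Finset.univ_sum_single x
  rw [Fintype.sum_sigma] at h
  simp only [LinearMap.sum_apply, LinearMap.id_apply]
  refine Eq.trans ?_ h
  refine Finset.sum_congr rfl fun j _ => Finset.sum_congr rfl fun a _ => ?_
  simp only [inj, prj, LinearMap.comp_apply, LinearMap.single_apply, LinearMap.proj_apply]

theorem prj_mu (V : Rep lam) {i j : I} (a : DArrow j i) : V.prj a ∘ₗ V.mu i = V.map a.star := by
  classical
  ext x
  simp only [prj, mu, inj, LinearMap.comp_apply, LinearMap.sum_apply, LinearMap.proj_apply,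
    Finset.sum_apply, LinearMap.single_apply]
  rw [← Fintype.sum_sigma (fun b : (Σ j : I, DArrow j i) =>
    (Pi.single (M := fun a : (Σ j : I, DArrow j i) => V.obj a.1) b (V.map b.2.star x)) ⟨j, a⟩)]
  rw [Finset.sum_eq_single ⟨j, a⟩]
  · simp
  · intro b _ hb
    exact Pi.single_eq_of_ne (M := fun a : (Σ j : I, DArrow j i) => V.obj a.1) hb.symm _
  · simp

theorem prj_inj_of_ne (V : Rep lam) {i j k : I} (a : DArrow j i) (b : DArrow k i)
    (h : (⟨j, a⟩ : Σ j : I, DArrow j i) ≠ ⟨k, b⟩) : V.prj a ∘ₗ V.inj b = 0 := by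
  classical
  ext x
  exact Pi.single_eq_of_ne (M := fun a : (Σ j : I, DArrow j i) => V.obj a.1) h _

theorem pi_inj (V : Rep lam) {i j : I} (a : DArrow j i) : V.pi i ∘ₗ V.inj a = eps K a • V.map a := by
  classical
  ext x
  simp only [pi, LinearMap.comp_apply, LinearMap.sum_apply, LinearMap.smul_apply]
  rw [← Fintype.sum_sigma (fun b : (Σ j : I, DArrow j i) =>
    eps K b.2 • (V.map b.2 (V.prj b.2 (V.inj a x))))]
  rw [Finset.sum_eq_single ⟨j, a⟩]
  · have := LinearMap.congr_fun (V.prj_inj a) x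
    simp only [LinearMap.comp_apply, LinearMap.id_apply] at this
    simp [this]
  · intro b _ hb
    have := LinearMap.congr_fun (V.prj_inj_of_ne b.2 a hb) x
    simp only [LinearMap.comp_apply, LinearMap.zero_apply] at this
    simp [this]
  · simp

theorem pi_mu (V : Rep lam) (i : I) : V.pi i ∘ₗ V.mu i = lam i • LinearMap.id := by
  rw [← V.rel i, pi]
  ext x
  simp only [LinearMap.comp_apply, LinearMap.sum_apply, LinearMap.smul_apply]
  refine Finset.sum_congr rfl fun j _ => Finset.sum_congr rfl fun a _ => ?_
  rw [← V.prj_mu a]; rfl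

theorem theta_mu (V : Rep lam) (i : I) : V.theta i ∘ₗ V.mu i = 0 := by
  rw [theta, LinearMap.sub_comp, LinearMap.comp_assoc, pi_mu]
  simp [LinearMap.comp_smul, LinearMap.smul_comp]

theorem pi_theta (V : Rep lam) (i : I) : V.pi i ∘ₗ V.theta i = 0 := by
  rw [theta, LinearMap.comp_sub, ← LinearMap.comp_assoc, pi_mu]
  simp [LinearMap.comp_smul, LinearMap.smul_comp]

theorem eps_mul_self {i j : I} (a : DArrow i j) : eps K a * eps K a = 1 := by
  rcases a with a | a <;> simp [eps]

theorem eps_star {i j : I} (a : DArrow i j) : eps K a.star = -eps K a := by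
  rcases a with a | a <;> simp [eps, DArrow.star]

/-! Changing a representation at the vertex `i` only. -/

/-- `X` at the vertex `i`, and `W j` at every vertex `j ≠ i`. -/
def ReplObj (X : Type u) (W : I → Type u) {i j : I} : Decidable (j = i) → Type u
  | isTrue _ => X
  | isFalse _ => W j

instance (X : Type u) (W : I → Type u) [AddCommGroup X] [∀ j, AddCommGroup (W j)] {i j : I} :
    (d : Decidable (j = i)) → AddCommGroup (ReplObj X W d)
  | isTrue _ => inferInstanceAs (AddCommGroup X)
  | isFalse _ => inferInstanceAs (AddCommGroup (W j))

instance (X : Type u) (W : I → Type u) [AddCommGroup X] [∀ j, AddCommGroup (W j)]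
    [Module K X] [∀ j, Module K (W j)] {i j : I} :
    (d : Decidable (j = i)) → Module K (ReplObj X W d)
  | isTrue _ => inferInstanceAs (Module K X)
  | isFalse _ => inferInstanceAs (Module K (W j))

variable (V : Rep lam) {i : I} {X : Type u} [AddCommGroup X] [Module K X]

/-- Linear maps for the arrows when `V_i` is replaced by `X`: `inn a` if `h(a) = i`, `out a` if
`t(a) = i`, and `V_a` if neither holds. (A loop at `i` would get `0`; there is none if `i` is loop-free.) -/
def replMap (inn : ∀ {j : I}, DArrow j i → (V.obj j →ₗ[K] X))
    (out : ∀ {k : I}, DArrow i k → (X →ₗ[K] V.obj k)) {j k : I} (a : DArrow j k) :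
    (dj : Decidable (j = i)) → (dk : Decidable (k = i)) →
      (ReplObj X V.obj dj →ₗ[K] ReplObj X V.obj dk)
  | isTrue _, isTrue _ => 0
  | isTrue hj, isFalse _ => (out (hj ▸ a : DArrow i k) : X →ₗ[K] V.obj k)
  | isFalse _, isTrue hk => (inn (hk ▸ a : DArrow j i) : V.obj j →ₗ[K] X)
  | isFalse _, isFalse _ => (V.map a : V.obj j →ₗ[K] V.obj k)


theorem star_star {i j : I} (a : DArrow i j) : a.star.star = a := Sum.swap_swap a

theorem replMap_rel (hi : LoopFree i) (hlam : lam' = reflWeight i lam)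
    (inn : ∀ {j : I}, DArrow j i → (V.obj j →ₗ[K] X))
    (out : ∀ {k : I}, DArrow i k → (X →ₗ[K] V.obj k))
    (hX : ∑ j : I, ∑ a : DArrow j i, eps K a • (inn a ∘ₗ out a.star) = -lam i • LinearMap.id)
    (hV : ∀ {k : I} (a : DArrow i k), eps K a • (out a ∘ₗ inn a.star) =
      eps K a • (V.map a ∘ₗ V.map a.star) + lam i • LinearMap.id)
    (dec : ∀ k : I, Decidable (k = i)) (j : I) (dj : Decidable (j = i)) :
    ∑ k : I, ∑ a : DArrow k j, eps K a •
      (V.replMap inn out a (dec k) dj ∘ₗ V.replMap inn out a.star dj (dec k)) =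
      lam' j • LinearMap.id := by
  rcases dj with hj | hj
  · have hterm : ∀ (k : I) (a : DArrow k j), eps K a • (V.replMap inn out a (dec k) (isFalse hj) ∘ₗ
        V.replMap inn out a.star (isFalse hj) (dec k)) =
        eps K a • (V.map a ∘ₗ V.map a.star) +
          if k = i then lam i • (LinearMap.id : V.obj j →ₗ[K] V.obj j) else 0 := by
      intro k a
      rcases dec k with hk | hk
      · rw [if_neg hk, add_zero]; rfl
      · subst hk
        rw [if_pos rfl]; exact hV a
    have hsum : ∑ k : I, ∑ _a : DArrow k j,
        (if k = i then lam i • (LinearMap.id : V.obj j →ₗ[K] V.obj j) else 0) =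
        ((Fintype.card (DArrow i j) : K) * lam i) • LinearMap.id := by
      rw [Finset.sum_eq_single i (fun k _ hk => by simp [hk]) (by simp)]
      rw [Finset.sum_const, if_pos rfl, Finset.card_univ, ← Nat.cast_smul_eq_nsmul K, smul_smul]
    refine (Finset.sum_congr rfl fun k _ => Finset.sum_congr rfl fun a _ => hterm k a).trans ?_
    have hadd : ∀ f g : ∀ k : I, DArrow k j → (V.obj j →ₗ[K] V.obj j),
        ∑ k : I, ∑ a : DArrow k j, (f k a + g k a) =
          ∑ k : I, ∑ a : DArrow k j, f k a + ∑ k : I, ∑ a : DArrow k j, g k a := by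
      intro f g
      simp only [Finset.sum_add_distrib]
    rw [hlam, reflWeight_of_ne hj]
    refine (hadd _ _).trans ?_
    refine (congrArg₂ (· + ·) (V.rel j) hsum).trans ?_
    exact (add_smul _ _ _).symm
  · subst hj
    have hterm : ∀ (k : I) (a : DArrow k j), eps K a • (V.replMap inn out a (dec k) (isTrue rfl) ∘ₗ
        V.replMap inn out a.star (isTrue rfl) (dec k)) = eps K a • (inn a ∘ₗ out a.star) := by
      intro k a
      rcases dec k with hk | hk
      · rfl
      · subst hk
        exact (Sum.elim hi.false hi.false a).elim
    refine (Finset.sum_congr rfl fun k _ => Finset.sum_congr rfl fun a _ => hterm k a).trans ?_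
    rw [hlam, reflWeight_self hi]
    exact hX

/-- The representation that has `X` at `i` and `V_j` at `j ≠ i`, with the map of `a` being
`ε(a) p μ_a` if `h(a) = i`, `π_{a*} q` if `t(a) = i`, and `V_a` otherwise. It is a representation for
the weight `r_i λ` if `q p = μ π - λ_i` and `p q = -λ_i`. -/
def reflect (hi : LoopFree i) (hlam : lam' = reflWeight i lam)
    (p : V.Oplus i →ₗ[K] X) (q : X →ₗ[K] V.Oplus i)
    (hqp : q ∘ₗ p = V.theta i) (hpq : p ∘ₗ q = -lam i • LinearMap.id) : Rep lam' where
  obj j := ReplObj X V.obj (inferInstance : Decidable (j = i))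
  map {j k} a := V.replMap (fun a => eps K a • (p ∘ₗ V.inj a)) (fun a => V.prj a.star ∘ₗ q) a _ _
  rel j := by
    refine V.replMap_rel hi hlam _ _ ?_ ?_ _ j _
    · have h : p ∘ₗ (∑ j : I, ∑ a : DArrow j i, V.inj a ∘ₗ V.prj a) ∘ₗ q =
          -lam i • LinearMap.id := by rw [sum_inj_prj, LinearMap.id_comp, hpq]
      rw [← h]
      ext x
      simp only [star_star, LinearMap.sum_apply, LinearMap.comp_apply, LinearMap.smul_apply,
        map_sum, smul_smul, eps_mul_self, one_smul]
    · intro k a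
      have h1 : V.prj a.star ∘ₗ V.theta i ∘ₗ V.inj a.star =
          eps K a.star • (V.map a ∘ₗ V.map a.star) - lam i • LinearMap.id := by
        rw [theta, LinearMap.sub_comp, LinearMap.comp_sub, LinearMap.comp_assoc, pi_inj,
          LinearMap.comp_smul, LinearMap.comp_smul, ← LinearMap.comp_assoc, prj_mu, star_star,
          LinearMap.smul_comp, LinearMap.comp_smul, LinearMap.id_comp, prj_inj]
      have h2 : (V.prj a.star ∘ₗ q) ∘ₗ (p ∘ₗ V.inj a.star) =
          V.prj a.star ∘ₗ V.theta i ∘ₗ V.inj a.star := by rw [← hqp]; rfl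
      rw [LinearMap.comp_smul, h2, h1, eps_star, smul_smul, mul_neg, eps_mul_self]
      simp [sub_eq_add_neg, add_comm]

/-- The map `⨁ f_{t(a)} : U_⊕ → V_⊕`. -/
def oplusMap {U V : Rep lam} (f : U ⟶ V) (i : I) : U.Oplus i →ₗ[K] V.Oplus i :=
  LinearMap.piMap fun a => f.app a.1

theorem prj_oplusMap {U V : Rep lam} (f : U ⟶ V) {i j : I} (a : DArrow j i) :
    V.prj a ∘ₗ oplusMap f i = f.app j ∘ₗ U.prj a := rfl

theorem oplusMap_inj {U V : Rep lam} (f : U ⟶ V) {i j : I} (a : DArrow j i) :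
    oplusMap f i ∘ₗ U.inj a = V.inj a ∘ₗ f.app j := by
  classical
  ext x : 1
  funext b
  by_cases hb : b = ⟨j, a⟩
  · subst hb
    simp [oplusMap, inj]
  · change f.app b.1 ((U.inj a x) b) = V.inj a (f.app j x) b
    simp only [inj, LinearMap.single_apply]
    rw [Pi.single_eq_of_ne hb, Pi.single_eq_of_ne hb, map_zero]

theorem oplusMap_mu {U V : Rep lam} (f : U ⟶ V) (i : I) :
    oplusMap f i ∘ₗ U.mu i = V.mu i ∘ₗ f.app i := by
  ext x : 1
  simp only [mu, LinearMap.comp_apply, LinearMap.sum_apply, map_sum]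
  refine Finset.sum_congr rfl fun j _ => Finset.sum_congr rfl fun a _ => ?_
  rw [← comm_apply f]
  exact LinearMap.congr_fun (oplusMap_inj f a) _

theorem pi_oplusMap {U V : Rep lam} (f : U ⟶ V) (i : I) :
    V.pi i ∘ₗ oplusMap f i = f.app i ∘ₗ U.pi i := by
  refine LinearMap.ext fun x => ?_
  simp only [pi, LinearMap.comp_apply, LinearMap.sum_apply, map_sum, LinearMap.smul_apply, map_smul]
  refine Finset.sum_congr rfl fun j _ => Finset.sum_congr rfl fun a _ => ?_
  rw [comm_apply f]
  rfl

theorem theta_oplusMap {U V : Rep lam} (f : U ⟶ V) (i : I) :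
    V.theta i ∘ₗ oplusMap f i = oplusMap f i ∘ₗ U.theta i := by
  simp only [theta, LinearMap.sub_comp, LinearMap.comp_sub, LinearMap.smul_comp,
    LinearMap.comp_smul, LinearMap.id_comp, LinearMap.comp_id]
  rw [LinearMap.comp_assoc, pi_oplusMap, ← LinearMap.comp_assoc, ← oplusMap_mu,
    LinearMap.comp_assoc]

theorem oplusMap_id (U : Rep lam) (i : I) : oplusMap (𝟙 U) i = LinearMap.id := rfl

theorem oplusMap_comp {U V W : Rep lam} (f : U ⟶ V) (g : V ⟶ W) (i : I) :
    oplusMap (f ≫ g) i = oplusMap g i ∘ₗ oplusMap f i := rfl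

/-- `g` at the vertex `i`, and `f_j` at every vertex `j ≠ i`. -/
def replApp {U V : Rep lam} (f : U ⟶ V) {i : I} {X Y : Type u} [AddCommGroup X] [Module K X]
    [AddCommGroup Y] [Module K Y] (g : X →ₗ[K] Y) (j : I) :
    (d : Decidable (j = i)) → (ReplObj X U.obj d →ₗ[K] ReplObj Y V.obj d)
  | isTrue _ => (g : X →ₗ[K] Y)
  | isFalse _ => (f.app j : U.obj j →ₗ[K] V.obj j)

/-- The morphism of representations given by `g` at `i` and by `f_j` at `j ≠ i`. -/
def reflectMap {U V : Rep lam} (f : U ⟶ V) {i : I} {X Y : Type u} [AddCommGroup X] [Module K X]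
    [AddCommGroup Y] [Module K Y] {hi : LoopFree i} {hlam : lam' = reflWeight i lam}
    {p : U.Oplus i →ₗ[K] X} {q : X →ₗ[K] U.Oplus i}
    {hqp : q ∘ₗ p = U.theta i} {hpq : p ∘ₗ q = -lam i • LinearMap.id}
    {p' : V.Oplus i →ₗ[K] Y} {q' : Y →ₗ[K] V.Oplus i}
    {hqp' : q' ∘ₗ p' = V.theta i} {hpq' : p' ∘ₗ q' = -lam i • LinearMap.id}
    (g : X →ₗ[K] Y) (hp : g ∘ₗ p = p' ∘ₗ oplusMap f i) (hq : q' ∘ₗ g = oplusMap f i ∘ₗ q) :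
    U.reflect hi hlam p q hqp hpq ⟶ V.reflect hi hlam p' q' hqp' hpq' where
  app j := replApp f g j _
  comm {j k} a := by
    have key : ∀ (dj : Decidable (j = i)) (dk : Decidable (k = i)),
        replApp f g k dk ∘ₗ U.replMap (fun a => eps K a • (p ∘ₗ U.inj a))
          (fun a => U.prj a.star ∘ₗ q) a dj dk =
        V.replMap (fun a => eps K a • (p' ∘ₗ V.inj a))
          (fun a => V.prj a.star ∘ₗ q') a dj dk ∘ₗ replApp f g j dj := by
      rintro (hj | hj) (hk | hk)
      · exact f.comm a
      · subst hk
        change g ∘ₗ (eps K a • (p ∘ₗ U.inj a)) = (eps K a • (p' ∘ₗ V.inj a)) ∘ₗ f.app j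
        rw [LinearMap.comp_smul, LinearMap.smul_comp, ← LinearMap.comp_assoc, hp,
          LinearMap.comp_assoc, oplusMap_inj, LinearMap.comp_assoc]
      · subst hj
        change f.app k ∘ₗ (U.prj a.star ∘ₗ q) = (V.prj a.star ∘ₗ q') ∘ₗ g
        rw [LinearMap.comp_assoc, hq, ← LinearMap.comp_assoc, ← LinearMap.comp_assoc, prj_oplusMap]
      · exact (LinearMap.comp_zero _).trans (LinearMap.zero_comp _).symm
    exact key _ _

theorem replApp_id (U : Rep lam) {i : I} {X : Type u} [AddCommGroup X] [Module K X] (j : I)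
    (d : Decidable (j = i)) :
    replApp (𝟙 U) (LinearMap.id : X →ₗ[K] X) j d = LinearMap.id := by
  cases d <;> rfl

theorem replApp_comp {U V W : Rep lam} (f : U ⟶ V) (f' : V ⟶ W) {i : I} {X Y Z : Type u}
    [AddCommGroup X] [Module K X] [AddCommGroup Y] [Module K Y] [AddCommGroup Z] [Module K Z]
    (g : X →ₗ[K] Y) (g' : Y →ₗ[K] Z) (j : I) (d : Decidable (j = i)) :
    replApp (f ≫ f') (g' ∘ₗ g) j d = replApp f' g' j d ∘ₗ replApp f g j d := by
  cases d <;> rfl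

/-! The cokernel reflection functor. -/
section Coker

variable (i)

/-- The cokernel of `μ`. -/
abbrev Coker : Type u := V.Oplus i ⧸ LinearMap.range (V.mu i)

/-- The canonical map `c : V_⊕ → Coker μ`. -/
def cokerC : V.Oplus i →ₗ[K] V.Coker i := (LinearMap.range (V.mu i)).mkQ

/-- The map `γ : Coker μ → V_⊕` with `γ c = μ π - λ_i`. -/
def cokerGamma : V.Coker i →ₗ[K] V.Oplus i :=
  (LinearMap.range (V.mu i)).liftQ (V.theta i) (LinearMap.range_le_ker_iff.2 (V.theta_mu i))

theorem cokerGamma_c : V.cokerGamma i ∘ₗ V.cokerC i = V.theta i :=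
  Submodule.liftQ_mkQ _ _ _

theorem c_mu : V.cokerC i ∘ₗ V.mu i = 0 := LinearMap.range_mkQ_comp _

theorem coker_c_gamma : V.cokerC i ∘ₗ V.cokerGamma i = -lam i • LinearMap.id := by
  refine Submodule.linearMap_qext _ ?_
  change V.cokerC i ∘ₗ (V.cokerGamma i ∘ₗ V.cokerC i) = _
  rw [cokerGamma_c, theta, LinearMap.comp_sub, ← LinearMap.comp_assoc, c_mu, LinearMap.zero_comp,
    LinearMap.comp_smul, zero_sub, LinearMap.comp_id]
  refine LinearMap.ext fun x => ?_
  exact (neg_smul (lam i) (V.cokerC i x)).symm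

/-- The map induced on cokernels. -/
def cokerMap {U V : Rep lam} (f : U ⟶ V) : U.Coker i →ₗ[K] V.Coker i :=
  (LinearMap.range (U.mu i)).mapQ (LinearMap.range (V.mu i)) (oplusMap f i) (by
    rintro _ ⟨x, rfl⟩
    exact ⟨f.app i x, (LinearMap.congr_fun (oplusMap_mu f i) x).symm⟩)

theorem cokerMap_c {U V : Rep lam} (f : U ⟶ V) :
    cokerMap i f ∘ₗ U.cokerC i = V.cokerC i ∘ₗ oplusMap f i := Submodule.mapQ_mkQ _ _ _

end Coker

/-- The cokernel reflection functor on representations: `Coker μ` at `i`, with maps `ε(a) c μ_a` for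
`h(a) = i` and `π_{a*} γ` for `t(a) = i`. The target weight is a variable `lam'` with
`lam' = r_i lam`, so that `r_i (r_i lam)` may be replaced by `lam`. -/
def cokerRefl (hi : LoopFree i) (hlam : lam' = reflWeight i lam) : Rep lam ⥤ Rep lam' where
  obj V := V.reflect hi hlam (V.cokerC i) (V.cokerGamma i) (V.cokerGamma_c i) (V.coker_c_gamma i)
  map {U V} f := reflectMap f (cokerMap i f) (cokerMap_c i f) (by
    refine Submodule.linearMap_qext _ ?_
    change V.cokerGamma i ∘ₗ (cokerMap i f ∘ₗ U.cokerC i) =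
      oplusMap f i ∘ₗ (U.cokerGamma i ∘ₗ U.cokerC i)
    rw [cokerMap_c, cokerGamma_c, ← LinearMap.comp_assoc, cokerGamma_c, theta_oplusMap])
  map_id U := Rep.hom_ext fun j => by
    have h : cokerMap i (𝟙 U) = LinearMap.id := Submodule.linearMap_qext _ rfl
    change replApp _ (cokerMap i (𝟙 U)) j _ = _
    rw [h]; exact replApp_id U j _
  map_comp {U V W} f g := Rep.hom_ext fun j => by
    have h : cokerMap i (f ≫ g) = cokerMap i g ∘ₗ cokerMap i f := Submodule.linearMap_qext _ rfl
    change replApp _ (cokerMap i (f ≫ g)) j _ = _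
    rw [h]; exact replApp_comp f g _ _ j _

/-! The kernel reflection functor. -/
section Ker

variable (i)

/-- The kernel of `π`. -/
abbrev Ker : Type u := LinearMap.ker (V.pi i)

/-- The inclusion `ι : Ker π → V_⊕`. -/
def kerIota : V.Ker i →ₗ[K] V.Oplus i := (LinearMap.ker (V.pi i)).subtype

/-- The map `γ : V_⊕ → Ker π` with `ι γ = μ π - λ_i`. -/
def kerGamma : V.Oplus i →ₗ[K] V.Ker i :=
  (V.theta i).codRestrict (LinearMap.ker (V.pi i)) fun x => LinearMap.congr_fun (V.pi_theta i) x

theorem iota_kerGamma : V.kerIota i ∘ₗ V.kerGamma i = V.theta i := rfl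

theorem kerGamma_iota : V.kerGamma i ∘ₗ V.kerIota i = -lam i • LinearMap.id := by
  refine LinearMap.ext fun x => Subtype.ext ?_
  change V.mu i (V.pi i x.1) - lam i • x.1 = -lam i • x.1
  rw [show V.pi i x.1 = 0 from x.2, map_zero, zero_sub, neg_smul]

/-- The map induced on kernels. -/
def kerMap {U V : Rep lam} (f : U ⟶ V) : U.Ker i →ₗ[K] V.Ker i :=
  (oplusMap f i).restrict fun x hx => by
    have := LinearMap.congr_fun (pi_oplusMap f i) x
    simp only [LinearMap.comp_apply] at this
    rw [LinearMap.mem_ker] at hx ⊢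
    rw [this, hx, map_zero]

end Ker

/-- The kernel reflection functor on representations: `Ker π` at `i`, with maps `ε(a) γ μ_a` for
`h(a) = i` and `π_{a*} ι` for `t(a) = i`. -/
def kerRefl (hi : LoopFree i) (hlam : lam' = reflWeight i lam) : Rep lam ⥤ Rep lam' where
  obj V := V.reflect hi hlam (V.kerGamma i) (V.kerIota i) (V.iota_kerGamma i) (V.kerGamma_iota i)
  map f := reflectMap f (kerMap i f)
    (LinearMap.ext fun x => Subtype.ext (LinearMap.congr_fun (theta_oplusMap f i) x).symm) rfl
  map_id U := Rep.hom_ext fun j => replApp_id U j _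
  map_comp f g := Rep.hom_ext fun j => replApp_comp f g (kerMap i f) (kerMap i g) j _

/-! The reflection functor of Crawley-Boevey and Holland, for `λ_i ≠ 0`. -/
section CBH

variable (i)

/-- The idempotent endomorphism `1 - λ_i⁻¹ μ π` of `V_⊕`. -/
def idem : V.Oplus i →ₗ[K] V.Oplus i := LinearMap.id - (lam i)⁻¹ • (V.mu i ∘ₗ V.pi i)

theorem smul_idem (h0 : lam i ≠ 0) : -lam i • V.idem i = V.theta i := by
  rw [idem, theta, smul_sub, smul_smul, neg_mul, mul_inv_cancel₀ h0]
  simp [sub_eq_add_neg, add_comm]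

theorem idem_idem (h0 : lam i ≠ 0) : V.idem i ∘ₗ V.idem i = V.idem i := by
  have h : V.pi i ∘ₗ V.idem i = 0 := by
    rw [idem, LinearMap.comp_sub, LinearMap.comp_smul, ← LinearMap.comp_assoc, pi_mu,
      LinearMap.smul_comp, smul_smul, inv_mul_cancel₀ h0]
    simp
  conv_lhs => enter [1]; rw [idem]
  rw [LinearMap.sub_comp, LinearMap.smul_comp, LinearMap.comp_assoc, h]
  simp

/-- The image of the idempotent. -/
abbrev CBHSpace : Type u := LinearMap.range (V.idem i)

/-- The inclusion of the image. -/
def cbhIncl : V.CBHSpace i →ₗ[K] V.Oplus i := (LinearMap.range (V.idem i)).subtype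

/-- `-λ_i (1 - λ_i⁻¹ μ π)`, as a map to the image of the idempotent. -/
def cbhProj : V.Oplus i →ₗ[K] V.CBHSpace i := -lam i • (V.idem i).rangeRestrict

theorem cbhIncl_proj (h0 : lam i ≠ 0) : V.cbhIncl i ∘ₗ V.cbhProj i = V.theta i :=
  V.smul_idem i h0

theorem cbhProj_incl (h0 : lam i ≠ 0) : V.cbhProj i ∘ₗ V.cbhIncl i = -lam i • LinearMap.id := by
  refine LinearMap.ext fun x => Subtype.ext ?_
  obtain ⟨_, y, rfl⟩ := x
  exact congrArg (-lam i • ·) (LinearMap.congr_fun (V.idem_idem i h0) y)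

theorem idem_oplusMap {U V : Rep lam} (f : U ⟶ V) :
    V.idem i ∘ₗ oplusMap f i = oplusMap f i ∘ₗ U.idem i := by
  simp only [idem, LinearMap.sub_comp, LinearMap.comp_sub, LinearMap.smul_comp,
    LinearMap.comp_smul, LinearMap.id_comp, LinearMap.comp_id]
  rw [LinearMap.comp_assoc, pi_oplusMap, ← LinearMap.comp_assoc, ← oplusMap_mu,
    LinearMap.comp_assoc]

/-- The induced map. -/
def cbhMap {U V : Rep lam} (f : U ⟶ V) : U.CBHSpace i →ₗ[K] V.CBHSpace i :=
  (oplusMap f i).restrict (by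
    rintro _ ⟨x, rfl⟩
    exact ⟨oplusMap f i x, LinearMap.congr_fun (idem_oplusMap i f) x⟩)

end CBH

/-- The reflection functor `E_i` of Crawley-Boevey and Holland on representations: the image of the
idempotent `1 - λ_i⁻¹ μ π` of `V_⊕` at `i`, with maps `ε(a) (-λ_i) (1 - λ_i⁻¹ μ π) μ_a` for `h(a) = i`
and the restriction of `π_{a*}` for `t(a) = i`. -/
def cbhRefl (hi : LoopFree i) (hlam : lam' = reflWeight i lam) (h0 : lam i ≠ 0) :
    Rep lam ⥤ Rep lam' where
  obj V := V.reflect hi hlam (V.cbhProj i) (V.cbhIncl i) (V.cbhIncl_proj i h0)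
    (V.cbhProj_incl i h0)
  map {U V} f := reflectMap f (cbhMap i f)
    (LinearMap.ext fun x => Subtype.ext <| by
      change oplusMap f i (-lam i • U.idem i x) = -lam i • V.idem i (oplusMap f i x)
      rw [map_smul]
      exact congrArg (-lam i • ·) (LinearMap.congr_fun (idem_oplusMap i f) x).symm) rfl
  map_id U := Rep.hom_ext fun j => replApp_id U j _
  map_comp f g := Rep.hom_ext fun j => replApp_comp f g (cbhMap i f) (cbhMap i g) j _

end Rep
end Reflection

section ModuleFunctors

variable {lam lam' : I → K} {i : I}

/-- The cokernel reflection functor `C_i` on modules, through the equivalence between modules and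
representations. -/
def cokerFunctor (hi : LoopFree i) (hlam : lam' = reflWeight i lam) :
    ModuleCat.{u} (DPA lam) ⥤ ModuleCat.{u} (DPA lam') :=
  modToRep lam ⋙ Rep.cokerRefl hi hlam ⋙ (modToRep lam').inv

/-- The kernel reflection functor `K_i` on modules. -/
def kerFunctor (hi : LoopFree i) (hlam : lam' = reflWeight i lam) :
    ModuleCat.{u} (DPA lam) ⥤ ModuleCat.{u} (DPA lam') :=
  modToRep lam ⋙ Rep.kerRefl hi hlam ⋙ (modToRep lam').inv

/-- The reflection functor `E_i` of Crawley-Boevey and Holland on modules. -/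
def cbhFunctor (hi : LoopFree i) (hlam : lam' = reflWeight i lam) (h0 : lam i ≠ 0) :
    ModuleCat.{u} (DPA lam) ⥤ ModuleCat.{u} (DPA lam') :=
  modToRep lam ⋙ Rep.cbhRefl hi hlam h0 ⋙ (modToRep lam').inv

/-- For `λ_i = 0`, the representation `S_i` with `K` at `i`, zero at the other vertices, and all
arrows acting as zero. -/
def simpleRep (lam : I → K) (i : I) (h : lam i = 0) : Rep lam where
  obj j := Rep.ReplObj K (fun _ : I => PUnit.{u + 1}) (inferInstance : Decidable (j = i))
  map _ := 0
  rel j := by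
    have key : ∀ d : Decidable (j = i),
        (0 : Rep.ReplObj K (fun _ : I => PUnit.{u + 1}) d →ₗ[K] _) = lam j • LinearMap.id := by
      rintro (hj | hj)
      · exact LinearMap.ext fun _ => rfl
      · subst hj
        rw [h, zero_smul]
    rw [← key]
    simp

/-- The ideal `I_i`: the annihilator of the simple module `S_i`. -/
def trivialIdeal (lam : I → K) (i : I) (h : lam i = 0) : Ideal (DPA lam) :=
  Module.annihilator (DPA lam) (simpleRep lam i h).toMod

instance (lam : I → K) (i : I) (h : lam i = 0) : (trivialIdeal lam i h).IsTwoSided :=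
  inferInstanceAs (Module.annihilator (DPA lam) (simpleRep lam i h).toMod).IsTwoSided

end ModuleFunctors
end
section IdealFunctors
open scoped TensorProduct

variable {A : Type u} [Ring A] (J : Ideal A) [J.IsTwoSided]

/-- Right multiplication by `a` on a two-sided ideal. -/
def rmul (a : A) : J →ₗ[A] J where
  toFun x := ⟨x.1 * a, J.mul_mem_right a x.2⟩
  map_add' x y := Subtype.ext (add_mul x.1 y.1 a)
  map_smul' b x := Subtype.ext (mul_assoc b x.1 a)

/-- The subgroup of `J ⊗_ℤ M` generated by the elements `x a ⊗ m - x ⊗ a m` (these are stable under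
the left action of `A`, so their `A`-span is the subgroup that they generate). -/
def balanced (M : Type u) [AddCommGroup M] [Module A M] : Submodule A (J ⊗[ℤ] M) :=
  Submodule.span A {t | ∃ (x : J) (a : A) (m : M), t = rmul J a x ⊗ₜ[ℤ] m - x ⊗ₜ[ℤ] (a • m)}

/-- The tensor product `J ⊗_A M` over the (noncommutative) ring `A`, with its left `A`-action. -/
abbrev IdealTensor (M : Type u) [AddCommGroup M] [Module A M] : Type u :=
  (J ⊗[ℤ] M) ⧸ balanced J M

/-- The map `J ⊗_A M → J ⊗_A N` induced by `f`. -/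
def idealTensorMap {M N : Type u} [AddCommGroup M] [Module A M] [AddCommGroup N] [Module A N]
    (f : M →ₗ[A] N) : IdealTensor J M →ₗ[A] IdealTensor J N :=
  (balanced J M).mapQ (balanced J N)
    (TensorProduct.AlgebraTensorModule.map LinearMap.id f.toAddMonoidHom.toIntLinearMap) <| by
    rw [balanced, Submodule.span_le]
    rintro _ ⟨x, a, m, rfl⟩
    refine Submodule.subset_span ⟨x, a, f m, ?_⟩
    simp

/-- The functor `J ⊗_A -` on left `A`-modules. -/
def tensorFunctor : ModuleCat.{u} A ⥤ ModuleCat.{u} A where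
  obj M := ModuleCat.of A (IdealTensor J M)
  map f := ModuleCat.ofHom (idealTensorMap J f.hom)
  map_id M := by
    refine ModuleCat.hom_ext (Submodule.linearMap_qext _ ?_)
    refine TensorProduct.AlgebraTensorModule.ext fun x m => ?_
    rfl
  map_comp f g := by
    refine ModuleCat.hom_ext (Submodule.linearMap_qext _ ?_)
    refine TensorProduct.AlgebraTensorModule.ext fun x m => ?_
    rfl

/-- The left `A`-module `Hom_A(J, M)` of left module homomorphisms, with `(a f)(x) = f(x a)`. -/
def IdealHom (M : Type u) [AddCommGroup M] [Module A M] : Type u := J →ₗ[A] M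

instance (M : Type u) [AddCommGroup M] [Module A M] : AddCommGroup (IdealHom J M) :=
  inferInstanceAs (AddCommGroup (J →ₗ[A] M))

variable {J} in
/-- An element of `IdealHom J M`, as a linear map. -/
def IdealHom.lin {M : Type u} [AddCommGroup M] [Module A M] (f : IdealHom J M) : J →ₗ[A] M := f

instance (M : Type u) [AddCommGroup M] [Module A M] : Module A (IdealHom J M) where
  smul a f := (f.lin ∘ₗ rmul J a : J →ₗ[A] M)
  one_smul f := LinearMap.ext fun x => congrArg f.lin (Subtype.ext (mul_one x.1))
  mul_smul a b f := LinearMap.ext fun x =>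
    congrArg f.lin (Subtype.ext (mul_assoc x.1 a b).symm)
  smul_zero _ := rfl
  smul_add _ _ _ := rfl
  add_smul a b f := LinearMap.ext fun x =>
    (congrArg f.lin (Subtype.ext (mul_add x.1 a b))).trans
      (map_add f.lin (rmul J a x) (rmul J b x))
  zero_smul f := LinearMap.ext fun x =>
    (congrArg f.lin (Subtype.ext (mul_zero x.1))).trans (map_zero f.lin)

/-- Postcomposition with `f`, as a map `Hom_A(J, M) → Hom_A(J, N)` of left `A`-modules. -/
def idealHomMap {M N : Type u} [AddCommGroup M] [Module A M] [AddCommGroup N] [Module A N]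
    (f : M →ₗ[A] N) : IdealHom J M →ₗ[A] IdealHom J N where
  toFun g := (f ∘ₗ g.lin : J →ₗ[A] N)
  map_add' g h := LinearMap.comp_add g.lin h.lin f
  map_smul' _ _ := rfl

/-- The functor `Hom_A(J, -)` on left `A`-modules. -/
def homFunctor : ModuleCat.{u} A ⥤ ModuleCat.{u} A where
  obj M := ModuleCat.of A (IdealHom J M)
  map f := ModuleCat.ofHom (idealHomMap J f.hom)

end IdealFunctors

end DeformedPreprojective

end DPADefinitions

open DeformedPreprojective

noncomputable section ReflectionFunctors

namespace DeformedPreprojective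

set_option linter.unusedSectionVars false

variable {K : Type u} [Field K] {I : Type u} [Quiver.{u} I] [Fintype I] [DecidableEq I]
  [∀ i j : I, Fintype (i ⟶ j)]

/-! Since `i` carries no loop, V_⊕ involves only the spaces away from `i`. A morphism V → W
therefore consists of maps f_j for j ≠ i that commute with the arrows away from `i`, and so induce
f_⊕ : V_⊕ → W_⊕, together with a map g at `i` satisfying μ g = f_⊕ μ and g π = π f_⊕ (`homMk`).
Write θ = μπ - λ_i for V. Both reflections keep V_⊕ and replace the pair (μ, π) by a factorisation
(q, p) of θ, namely (γ, c) for C_i and (ι, γ) for K_i (`reflectOplus_mu`, `reflectAt_pi`).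

Adjunction. In C_i(V) the new π is c, which is onto, so a morphism out of C_i(V) is determined away
from `i`; in K_i(W) the new μ is ι, which is injective, so a morphism into K_i(W) is determined away
from `i`. Because (r_iλ)_i = -λ_i, the family (f_j) extends to a morphism C_i(V) → W, or to a
morphism V → K_i(W), under the same two conditions: π f_⊕ μ = 0 and f_⊕ θ = μ π f_⊕. This is the
bijection `cokerKerEquiv`.

Case λ_i ≠ 0. Since πμ = λ_i is invertible, θ induces an isomorphism Coker μ → Ker π, and Ker π is
the image of 1 - λ_i⁻¹μπ; hence C_i, K_i and E_i agree. At `i` the counit C_i K_i(W) → W is the map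
W_⊕/Ker π → W_i induced by π. It is always injective, and it is onto because πμ is invertible
(`isIso_counit`). Together with C_i ≅ K_i this gives C_i C_i ≅ id.

Case λ_i = 0. A homomorphism φ in e_j Hom(I_i, M) satisfies φ(x) = φ(x e_j). For j ≠ i the
idempotent e_j lies in I_i, so φ amounts to φ(e_j) ∈ e_j M. For j = i, the left ideal I_i e_i is
generated by the arrows a* leaving `i` (`exists_mul_e_eq_of_mem`), and the relation ∑ ε(a) a a* = 0
puts the family (φ(a*))_a in Ker π. Every m ∈ Ker π occurs: it defines an extension of S_i by M, and
φ(x) = x s, where s lifts the generator of S_i; this lies in M because x kills S_i (`extHom`). Hence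
Hom(I_i, -) ≅ K_i. Finally I_i ⊗ - and C_i are left adjoint to isomorphic functors, so they are
isomorphic. -/

theorem LoopFree.ne {i j : I} (hi : LoopFree i) (a : DArrow j i) : j ≠ i := by
  rintro rfl
  exact a.elim hi.false hi.false

namespace Rep

variable {lam lam' : I → K} {i : I}

/-! ### Morphisms given separately at the vertex `i` and away from it -/

/-- The map `V_⊕ → W_⊕` induced by maps `V_j → W_j` for `j ≠ i`. -/
def awayOplus (hi : LoopFree i) {V : Rep lam} {W : Rep lam'}
    (f : ∀ j, j ≠ i → (V.obj j →ₗ[K] W.obj j)) : V.Oplus i →ₗ[K] W.Oplus i :=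
  LinearMap.piMap fun a => f a.1 (hi.ne a.2)

theorem prj_awayOplus (hi : LoopFree i) {V : Rep lam} {W : Rep lam'}
    (f : ∀ j, j ≠ i → (V.obj j →ₗ[K] W.obj j)) {j : I} (a : DArrow j i) (x : V.Oplus i) :
    W.prj a (awayOplus hi f x) = f j (hi.ne a) (V.prj a x) := rfl

theorem awayOplus_inj (hi : LoopFree i) {V : Rep lam} {W : Rep lam'}
    (f : ∀ j, j ≠ i → (V.obj j →ₗ[K] W.obj j)) {j : I} (a : DArrow j i) (x : V.obj j) :
    awayOplus hi f (V.inj a x) = W.inj a (f j (hi.ne a) x) := by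
  classical
  funext b
  by_cases hb : b = ⟨j, a⟩
  · subst hb
    simp [awayOplus, inj]
  · change f b.1 (hi.ne b.2) ((V.inj a x) b) = W.inj a (f j _ x) b
    simp only [inj, LinearMap.single_apply]
    rw [Pi.single_eq_of_ne hb, Pi.single_eq_of_ne hb, map_zero]

theorem prj_mu_apply (V : Rep lam) {j : I} (a : DArrow j i) (x : V.obj i) :
    V.prj a (V.mu i x) = V.map a.star x := LinearMap.congr_fun (V.prj_mu a) x

theorem pi_inj_apply (V : Rep lam) {j : I} (a : DArrow j i) (x : V.obj j) :
    V.pi i (V.inj a x) = eps K a • V.map a x := LinearMap.congr_fun (V.pi_inj a) x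

/-- As ε(a)² = 1, arrows into `i` are recovered from π, just as arrows out of `i` are recovered from
μ by `prj_mu_apply`. -/
theorem map_eq_eps_pi_inj (V : Rep lam) {j : I} (a : DArrow j i) (x : V.obj j) :
    V.map a x = eps K a • V.pi i (V.inj a x) := by
  rw [pi_inj_apply, smul_smul, eps_mul_self, one_smul]

/-- The morphism of representations with components `g` at `i` and `f j` at `j ≠ i`. -/
def homMk (hi : LoopFree i) {V W : Rep lam} (g : V.obj i →ₗ[K] W.obj i)
    (f : ∀ j, j ≠ i → (V.obj j →ₗ[K] W.obj j))
    (hf : ∀ (j k : I) (hj : j ≠ i) (hk : k ≠ i) (a : DArrow j k) (x : V.obj j),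
      f k hk (V.map a x) = W.map a (f j hj x))
    (hmu : ∀ x, W.mu i (g x) = awayOplus hi f (V.mu i x))
    (hpi : ∀ x, g (V.pi i x) = W.pi i (awayOplus hi f x)) : V ⟶ W where
  app j := if h : j = i then (by subst h; exact g) else f j h
  comm {j k} a := by
    refine LinearMap.ext fun x => ?_
    by_cases hj : j = i
    · subst hj
      have hk : k ≠ j := hi.ne a.star
      simp only [LinearMap.comp_apply, dif_pos, dif_neg hk]
      -- The component of μ at a* is the map of a, so `hmu` read at a* is commutation with a.
      have := congrArg (W.prj a.star) (hmu x)
      rw [prj_mu_apply, prj_awayOplus, prj_mu_apply, star_star] at this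
      exact this.symm
    · by_cases hk : k = i
      · subst hk
        simp only [LinearMap.comp_apply, dif_pos, dif_neg hj]
        rw [map_eq_eps_pi_inj, map_eq_eps_pi_inj, map_smul, hpi, awayOplus_inj]
      · simp only [LinearMap.comp_apply, dif_neg hj, dif_neg hk]
        exact hf j k hj hk a x

section homMk
variable (hi : LoopFree i) {V W : Rep lam} (g : V.obj i →ₗ[K] W.obj i)
    (f : ∀ j, j ≠ i → (V.obj j →ₗ[K] W.obj j))
    (hf : ∀ (j k : I) (hj : j ≠ i) (hk : k ≠ i) (a : DArrow j k) (x : V.obj j),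
      f k hk (V.map a x) = W.map a (f j hj x))
    (hmu : ∀ x, W.mu i (g x) = awayOplus hi f (V.mu i x))
    (hpi : ∀ x, g (V.pi i x) = W.pi i (awayOplus hi f x))

theorem homMk_app_self : (homMk hi g f hf hmu hpi).app i = g := dif_pos rfl

theorem homMk_app_of_ne {j : I} (hj : j ≠ i) : (homMk hi g f hf hmu hpi).app j = f j hj :=
  dif_neg hj

end homMk

theorem mu_app {U V : Rep lam} (f : U ⟶ V) (x : U.obj i) :
    V.mu i (f.app i x) = oplusMap f i (U.mu i x) :=
  (LinearMap.congr_fun (oplusMap_mu f i) x).symm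

theorem app_pi {U V : Rep lam} (f : U ⟶ V) (x : U.Oplus i) :
    f.app i (U.pi i x) = V.pi i (oplusMap f i x) :=
  (LinearMap.congr_fun (pi_oplusMap f i) x).symm

theorem pi_mu_apply (V : Rep lam) (x : V.obj i) : V.pi i (V.mu i x) = lam i • x :=
  LinearMap.congr_fun (V.pi_mu i) x

/-- No arrow into `i` starts at `i`, so the component of a morphism at `i` does not enter V_⊕. -/
theorem oplusMap_congr {U V : Rep lam} (hi : LoopFree i) {f g : U ⟶ V}
    (h : ∀ j, j ≠ i → f.app j = g.app j) : oplusMap f i = oplusMap g i := by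
  refine LinearMap.ext fun x => funext fun a => ?_
  exact LinearMap.congr_fun (h a.1 (hi.ne a.2)) (x a)

theorem isIso_of_bijective {U V : Rep lam} (f : U ⟶ V)
    (h : ∀ j, Function.Bijective (f.app j)) : IsIso f := by
  let e : ∀ j, U.obj j ≃ₗ[K] V.obj j := fun j => LinearEquiv.ofBijective (f.app j) (h j)
  refine ⟨⟨fun j => (e j).symm.toLinearMap, fun {j k} a => LinearMap.ext fun y => ?_⟩, ?_, ?_⟩
  · obtain ⟨x, rfl⟩ := (e j).surjective y
    refine (e k).injective ?_
    simp only [LinearMap.comp_apply, LinearEquiv.coe_coe, LinearEquiv.apply_symm_apply,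
      LinearEquiv.symm_apply_apply]
    exact (comm_apply f a x).symm
  · exact Rep.hom_ext fun j => LinearMap.ext fun x => (e j).symm_apply_apply x
  · exact Rep.hom_ext fun j => LinearMap.ext fun x => (e j).apply_symm_apply x

/-! ### The components of a reflected representation -/

/-- `ReplObj X W` at the vertex `i` is `X`. -/
def replAt (X : Type u) (W : I → Type u) [AddCommGroup X] [∀ j, AddCommGroup (W j)]
    [Module K X] [∀ j, Module K (W j)] {i j : I} :
    (d : Decidable (j = i)) → j = i → (ReplObj X W d ≃ₗ[K] X)
  | isTrue _, _ => LinearEquiv.refl K X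
  | isFalse hne, heq => absurd heq hne

/-- `ReplObj X W` at a vertex `j ≠ i` is `W j`. -/
def replNe (X : Type u) (W : I → Type u) [AddCommGroup X] [∀ j, AddCommGroup (W j)]
    [Module K X] [∀ j, Module K (W j)] {i j : I} :
    (d : Decidable (j = i)) → j ≠ i → (ReplObj X W d ≃ₗ[K] W j)
  | isTrue heq, hne => absurd heq hne
  | isFalse _, _ => LinearEquiv.refl K (W j)

section
variable (V : Rep lam) {X : Type u} [AddCommGroup X] [Module K X]
  (inn : ∀ {j : I}, DArrow j i → (V.obj j →ₗ[K] X))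
  (out : ∀ {k : I}, DArrow i k → (X →ₗ[K] V.obj k))

/-- The two decisions are kept as variables: a case split on them makes both sides agree by
definition. The same device serves `replMap_inn` and `replMap_away`. -/
theorem replMap_out {k : I} (a : DArrow i k) (di : Decidable (i = i)) (dk : Decidable (k = i))
    (hk : k ≠ i) (x : ReplObj X V.obj di) :
    replNe (K := K) X V.obj dk hk (V.replMap inn out a di dk x) =
      out a (replAt (K := K) X V.obj di rfl x) := by
  rcases di with h | h
  · exact absurd rfl h
  · rcases dk with h' | h'
    · rfl
    · exact absurd h' hk

theorem replMap_inn {j : I} (a : DArrow j i) (dj : Decidable (j = i)) (di : Decidable (i = i))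
    (hj : j ≠ i) (x : ReplObj X V.obj dj) :
    replAt (K := K) X V.obj di rfl (V.replMap inn out a dj di x) =
      inn a (replNe (K := K) X V.obj dj hj x) := by
  rcases di with h | h
  · exact absurd rfl h
  · rcases dj with h' | h'
    · rfl
    · exact absurd h' hj

theorem replMap_away {j k : I} (a : DArrow j k) (dj : Decidable (j = i)) (dk : Decidable (k = i))
    (hj : j ≠ i) (hk : k ≠ i) (x : ReplObj X V.obj dj) :
    replNe (K := K) X V.obj dk hk (V.replMap inn out a dj dk x) =
      V.map a (replNe (K := K) X V.obj dj hj x) := by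
  rcases dj with h | h
  · rcases dk with h' | h'
    · rfl
    · exact absurd h' hk
  · exact absurd h hj

end

section reflect
variable (V : Rep lam) {X : Type u} [AddCommGroup X] [Module K X]
  (hi : LoopFree i) (hlam : lam' = reflWeight i lam)
  (p : V.Oplus i →ₗ[K] X) (q : X →ₗ[K] V.Oplus i)
  (hqp : q ∘ₗ p = V.theta i) (hpq : p ∘ₗ q = -lam i • LinearMap.id)

/-- The space of a reflected representation at `i`. -/
def reflectAt : (V.reflect hi hlam p q hqp hpq).obj i ≃ₗ[K] X :=
  replAt X V.obj (inferInstance : Decidable (i = i)) rfl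

/-- The space of a reflected representation at `j ≠ i`. -/
def reflectNe (j : I) (hj : j ≠ i) : (V.reflect hi hlam p q hqp hpq).obj j ≃ₗ[K] V.obj j :=
  replNe X V.obj (inferInstance : Decidable (j = i)) hj

/-- Reflection does not change `V_⊕`. -/
def reflectOplus : (V.reflect hi hlam p q hqp hpq).Oplus i ≃ₗ[K] V.Oplus i :=
  LinearEquiv.piCongrRight fun a => V.reflectNe hi hlam p q hqp hpq a.1 (hi.ne a.2)

theorem reflectOplus_inj {j : I} (a : DArrow j i)
    (x : (V.reflect hi hlam p q hqp hpq).obj j) :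
    V.reflectOplus hi hlam p q hqp hpq ((V.reflect hi hlam p q hqp hpq).inj a x) =
      V.inj a (V.reflectNe hi hlam p q hqp hpq j (hi.ne a) x) :=
  awayOplus_inj hi (fun j hj => (V.reflectNe hi hlam p q hqp hpq j hj).toLinearMap) a x

theorem reflectNe_map {j k : I} (hj : j ≠ i) (hk : k ≠ i) (a : DArrow j k)
    (x : (V.reflect hi hlam p q hqp hpq).obj j) :
    V.reflectNe hi hlam p q hqp hpq k hk ((V.reflect hi hlam p q hqp hpq).map a x) =
      V.map a (V.reflectNe hi hlam p q hqp hpq j hj x) :=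
  V.replMap_away _ _ a _ _ hj hk x

/-- The component of μ at a is the map of a*, which after reflection is π_a q. Together with
`reflectAt_pi` this says that the reflected representation has (q, p) as its pair (μ, π); the
adjunction handles the vertex `i` only through this fact. -/
theorem reflectOplus_mu (x : (V.reflect hi hlam p q hqp hpq).obj i) :
    V.reflectOplus hi hlam p q hqp hpq ((V.reflect hi hlam p q hqp hpq).mu i x) =
      q (V.reflectAt hi hlam p q hqp hpq x) := by
  funext ⟨j, a⟩
  change V.reflectNe hi hlam p q hqp hpq j (hi.ne a)
    ((V.reflect hi hlam p q hqp hpq).prj a ((V.reflect hi hlam p q hqp hpq).mu i x)) = _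
  rw [prj_mu_apply]
  refine (V.replMap_out _ _ a.star _ _ (hi.ne a) x).trans ?_
  rw [star_star]
  rfl

/-- On each summand of x = ∑ μ_a π_a x two signs ε(a) cancel, one from the definition of π and one
from the reflected map of a. -/
theorem reflectAt_pi (x : (V.reflect hi hlam p q hqp hpq).Oplus i) :
    V.reflectAt hi hlam p q hqp hpq ((V.reflect hi hlam p q hqp hpq).pi i x) =
      p (V.reflectOplus hi hlam p q hqp hpq x) := by
  have h := LinearMap.congr_fun ((V.reflect hi hlam p q hqp hpq).sum_inj_prj i) x
  simp only [LinearMap.sum_apply, LinearMap.comp_apply, LinearMap.id_apply] at h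
  rw [← h]
  simp only [map_sum]
  refine Finset.sum_congr rfl fun j _ => Finset.sum_congr rfl fun a _ => ?_
  rw [pi_inj_apply, map_smul, reflectOplus_inj]
  refine (congrArg (eps K a • ·) (V.replMap_inn _ _ a _ _ (hi.ne a) _)).trans ?_
  refine (smul_smul _ _ _).trans ?_
  rw [eps_mul_self, one_smul]
  rfl

end reflect

end Rep

namespace Rep

variable {lam lam' : I → K} {i : I}

/-! ### The adjunction -/

theorem hom_ext_away {U V : Rep lam} {f g : U ⟶ V}
    (h : ∀ j, j ≠ i → f.app j = g.app j) (hat : f.app i = g.app i) : f = g :=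
  Rep.hom_ext fun j => by
    by_cases hj : j = i
    · subst hj; exact hat
    · exact h j hj

/-- The identity f_i π = π f_⊕ forces f_i when π is onto. This applies to morphisms out of C_i(V),
whose π is c, so identities between them need checking only where reflection changes nothing. -/
theorem hom_ext_of_pi_surjective (hi : LoopFree i) {U V : Rep lam} {f g : U ⟶ V}
    (hU : Function.Surjective (U.pi i)) (h : ∀ j, j ≠ i → f.app j = g.app j) : f = g := by
  refine hom_ext_away h (LinearMap.ext fun x => ?_)
  obtain ⟨y, rfl⟩ := hU x
  rw [app_pi, app_pi, oplusMap_congr hi h]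

/-- Dually, μ f_i = f_⊕ μ forces f_i when μ is injective, as for morphisms into K_i(W), whose μ is
the inclusion of Ker π. -/
theorem hom_ext_of_mu_injective (hi : LoopFree i) {U V : Rep lam} {f g : U ⟶ V}
    (hV : Function.Injective (V.mu i)) (h : ∀ j, j ≠ i → f.app j = g.app j) : f = g := by
  refine hom_ext_away h (LinearMap.ext fun x => hV ?_)
  rw [mu_app, mu_app, oplusMap_congr hi h]

/-! ### Components of C_i(V) and K_i(V) -/

section coker
variable (V : Rep lam) (hi : LoopFree i) (hlam : lam' = reflWeight i lam)

/-- `C_i(V)_i = Coker μ`. -/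
def cokerAt : ((cokerRefl hi hlam).obj V).obj i ≃ₗ[K] V.Coker i :=
  V.reflectAt hi hlam _ _ (V.cokerGamma_c i) (V.coker_c_gamma i)

/-- `C_i(V)_j = V_j` for `j ≠ i`. -/
def cokerNe (j : I) (hj : j ≠ i) : ((cokerRefl hi hlam).obj V).obj j ≃ₗ[K] V.obj j :=
  V.reflectNe hi hlam _ _ (V.cokerGamma_c i) (V.coker_c_gamma i) j hj

/-- `C_i(V)_⊕ = V_⊕`. -/
def cokerOplus : ((cokerRefl hi hlam).obj V).Oplus i ≃ₗ[K] V.Oplus i :=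
  V.reflectOplus hi hlam _ _ (V.cokerGamma_c i) (V.coker_c_gamma i)

theorem cokerNe_map {j k : I} (hj : j ≠ i) (hk : k ≠ i) (a : DArrow j k)
    (x : ((cokerRefl hi hlam).obj V).obj j) :
    V.cokerNe hi hlam k hk (((cokerRefl hi hlam).obj V).map a x) =
      V.map a (V.cokerNe hi hlam j hj x) := V.reflectNe_map hi hlam _ _ _ _ hj hk a x

theorem cokerOplus_mu (x : ((cokerRefl hi hlam).obj V).obj i) :
    V.cokerOplus hi hlam (((cokerRefl hi hlam).obj V).mu i x) =
      V.cokerGamma i (V.cokerAt hi hlam x) := V.reflectOplus_mu hi hlam _ _ _ _ x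

theorem cokerAt_pi (x : ((cokerRefl hi hlam).obj V).Oplus i) :
    V.cokerAt hi hlam (((cokerRefl hi hlam).obj V).pi i x) =
      V.cokerC i (V.cokerOplus hi hlam x) := V.reflectAt_pi hi hlam _ _ _ _ x

theorem cokerC_surjective : Function.Surjective (V.cokerC i) := Submodule.mkQ_surjective _

theorem pi_cokerRefl_surjective : Function.Surjective (((cokerRefl hi hlam).obj V).pi i) := by
  intro x
  obtain ⟨y, hy⟩ := V.cokerC_surjective (V.cokerAt hi hlam x)
  refine ⟨(V.cokerOplus hi hlam).symm y, (V.cokerAt hi hlam).injective ?_⟩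
  rw [cokerAt_pi, LinearEquiv.apply_symm_apply, hy]

end coker

section ker
variable (V : Rep lam) (hi : LoopFree i) (hlam : lam' = reflWeight i lam)

/-- `K_i(V)_i = Ker π`. -/
def kerAt : ((kerRefl hi hlam).obj V).obj i ≃ₗ[K] V.Ker i :=
  V.reflectAt hi hlam _ _ (V.iota_kerGamma i) (V.kerGamma_iota i)

/-- `K_i(V)_j = V_j` for `j ≠ i`. -/
def kerNe (j : I) (hj : j ≠ i) : ((kerRefl hi hlam).obj V).obj j ≃ₗ[K] V.obj j :=
  V.reflectNe hi hlam _ _ (V.iota_kerGamma i) (V.kerGamma_iota i) j hj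

/-- `K_i(V)_⊕ = V_⊕`. -/
def kerOplus : ((kerRefl hi hlam).obj V).Oplus i ≃ₗ[K] V.Oplus i :=
  V.reflectOplus hi hlam _ _ (V.iota_kerGamma i) (V.kerGamma_iota i)

theorem kerOplus_apply (x : ((kerRefl hi hlam).obj V).Oplus i) (a : Σ j : I, DArrow j i) :
    V.kerOplus hi hlam x a = V.kerNe hi hlam a.1 (hi.ne a.2) (x a) := rfl

theorem kerNe_map {j k : I} (hj : j ≠ i) (hk : k ≠ i) (a : DArrow j k)
    (x : ((kerRefl hi hlam).obj V).obj j) :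
    V.kerNe hi hlam k hk (((kerRefl hi hlam).obj V).map a x) =
      V.map a (V.kerNe hi hlam j hj x) := V.reflectNe_map hi hlam _ _ _ _ hj hk a x

theorem kerOplus_mu (x : ((kerRefl hi hlam).obj V).obj i) :
    V.kerOplus hi hlam (((kerRefl hi hlam).obj V).mu i x) =
      (V.kerAt hi hlam x).1 := V.reflectOplus_mu hi hlam _ _ _ _ x

theorem kerAt_pi (x : ((kerRefl hi hlam).obj V).Oplus i) :
    V.kerAt hi hlam (((kerRefl hi hlam).obj V).pi i x) =
      V.kerGamma i (V.kerOplus hi hlam x) := V.reflectAt_pi hi hlam _ _ _ _ x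

theorem kerGamma_coe (x : V.Oplus i) :
    (V.kerGamma i x : V.Oplus i) = V.mu i (V.pi i x) - lam i • x := rfl

theorem mu_kerRefl_injective : Function.Injective (((kerRefl hi hlam).obj V).mu i) := by
  intro x y h
  refine (V.kerAt hi hlam).injective (Subtype.ext ?_)
  rw [← kerOplus_mu, ← kerOplus_mu, h]

end ker

theorem replApp_ne {U V : Rep lam} (f : U ⟶ V) {X Y : Type u} [AddCommGroup X] [Module K X]
    [AddCommGroup Y] [Module K Y] (g : X →ₗ[K] Y) (j : I) (hj : j ≠ i) (d : Decidable (j = i))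
    (x : ReplObj X U.obj d) :
    replNe (K := K) Y V.obj d hj (replApp f g j d x) =
      f.app j (replNe (K := K) X U.obj d hj x) := by
  rcases d with h | h
  · rfl
  · exact absurd h hj

theorem cokerNe_cokerRefl_map {U V : Rep lam} (hi : LoopFree i) (hlam : lam' = reflWeight i lam)
    (f : U ⟶ V) (j : I) (hj : j ≠ i) (x : ((cokerRefl hi hlam).obj U).obj j) :
    V.cokerNe hi hlam j hj (((cokerRefl hi hlam).map f).app j x) =
      f.app j (U.cokerNe hi hlam j hj x) := replApp_ne f (cokerMap i f) j hj _ x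

theorem kerNe_kerRefl_map {U V : Rep lam} (hi : LoopFree i) (hlam : lam' = reflWeight i lam)
    (f : U ⟶ V) (j : I) (hj : j ≠ i) (x : ((kerRefl hi hlam).obj U).obj j) :
    V.kerNe hi hlam j hj (((kerRefl hi hlam).map f).app j x) =
      f.app j (U.kerNe hi hlam j hj x) := replApp_ne f (kerMap i f) j hj _ x

/-! ### Passing between morphisms C_i(V) → W and V → K_i(W) -/

section homEquiv

variable (hi : LoopFree i) (hlam : lam' = reflWeight i lam) (hlam' : lam = reflWeight i lam')
  {V : Rep lam} {W : Rep lam'}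

theorem weight_at (hi : LoopFree i) (hlam : lam' = reflWeight i lam) :
    lam' i = -lam i := by rw [hlam, reflWeight_self hi]

/-- The map `V_⊕ → W_⊕` of a morphism `C_i(V) → W`. -/
def fromCokerOplus (g : (cokerRefl hi hlam).obj V ⟶ W) : V.Oplus i →ₗ[K] W.Oplus i :=
  oplusMap g i ∘ₗ (V.cokerOplus hi hlam).symm.toLinearMap

theorem pi_fromCokerOplus (g : (cokerRefl hi hlam).obj V ⟶ W) (x : V.Oplus i) :
    W.pi i (fromCokerOplus hi hlam g x) =
      g.app i ((V.cokerAt hi hlam).symm (V.cokerC i x)) := by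
  rw [fromCokerOplus, LinearMap.comp_apply, ← app_pi]
  congr 1
  rw [LinearEquiv.eq_symm_apply, cokerAt_pi]
  exact congrArg _ (LinearEquiv.apply_symm_apply _ _)

/-- π f_⊕ factors through c, and c μ = 0. So f_⊕ μ lands in Ker π, and this supplies the component
at `i` of V → K_i(W). -/
theorem pi_fromCokerOplus_mu (g : (cokerRefl hi hlam).obj V ⟶ W) (x : V.obj i) :
    W.pi i (fromCokerOplus hi hlam g (V.mu i x)) = 0 := by
  rw [pi_fromCokerOplus, show V.cokerC i (V.mu i x) = 0 from LinearMap.congr_fun (V.c_mu i) x,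
    map_zero, map_zero]

/-- Compatibility of g with μ reads f_⊕ γ = μ g_i; composed with c it becomes f_⊕ θ = μ π f_⊕. Since
λ'_i = -λ_i, the scalar term can be moved to the side of W, which gives the compatibility with π
required of a morphism into K_i(W). -/
theorem fromCokerOplus_theta (g : (cokerRefl hi hlam).obj V ⟶ W) (x : V.Oplus i) :
    fromCokerOplus hi hlam g (V.mu i (V.pi i x)) =
      W.mu i (W.pi i (fromCokerOplus hi hlam g x)) - lam' i • fromCokerOplus hi hlam g x := by
  have h : fromCokerOplus hi hlam g (V.theta i x) =
      W.mu i (W.pi i (fromCokerOplus hi hlam g x)) := by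
    rw [pi_fromCokerOplus, mu_app, fromCokerOplus, LinearMap.comp_apply]
    congr 1
    rw [LinearEquiv.coe_coe, LinearEquiv.symm_apply_eq, cokerOplus_mu,
      LinearEquiv.apply_symm_apply]
    exact (LinearMap.congr_fun (V.cokerGamma_c i) x).symm
  rw [← h, weight_at hi hlam, theta, LinearMap.sub_apply, map_sub]
  simp

/-- The morphism `V → K_i(W)` attached to a morphism `C_i(V) → W`. -/
def toKer (g : (cokerRefl hi hlam).obj V ⟶ W) : V ⟶ (kerRefl hi hlam').obj W :=
  homMk hi
    ((W.kerAt hi hlam').symm.toLinearMap ∘ₗ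
      (fromCokerOplus hi hlam g ∘ₗ V.mu i).codRestrict (LinearMap.ker (W.pi i))
        (fun x => pi_fromCokerOplus_mu hi hlam g x))
    (fun j hj => (W.kerNe hi hlam' j hj).symm.toLinearMap ∘ₗ g.app j ∘ₗ
      (V.cokerNe hi hlam j hj).symm.toLinearMap)
    (fun j k hj hk a x => by
      refine (W.kerNe hi hlam' k hk).injective ?_
      rw [kerNe_map W hi hlam' hj hk]
      simp only [LinearMap.comp_apply, LinearEquiv.coe_coe, LinearEquiv.apply_symm_apply]
      rw [← comm_apply g]
      congr 1
      rw [LinearEquiv.symm_apply_eq, cokerNe_map V hi hlam hj hk, LinearEquiv.apply_symm_apply])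
    (fun x => by
      refine (W.kerOplus hi hlam').injective ?_
      rw [kerOplus_mu]
      refine (congrArg Subtype.val (LinearEquiv.apply_symm_apply _ _)).trans (funext fun a => ?_)
      rw [kerOplus_apply]
      exact (LinearEquiv.apply_symm_apply _ _).symm)
    (fun x => by
      refine (W.kerAt hi hlam').injective ?_
      rw [kerAt_pi]
      refine (LinearEquiv.apply_symm_apply _ _).trans (Subtype.ext ?_)
      refine (fromCokerOplus_theta hi hlam g x).trans ?_
      rw [kerGamma_coe]
      have h : fromCokerOplus hi hlam g x = W.kerOplus hi hlam' (awayOplus hi (fun j hj =>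
          (W.kerNe hi hlam' j hj).symm.toLinearMap ∘ₗ g.app j ∘ₗ
            (V.cokerNe hi hlam j hj).symm.toLinearMap) x) := by
        funext a
        rw [kerOplus_apply]
        exact (LinearEquiv.apply_symm_apply _ _).symm
      rw [h])

theorem toKer_app (g : (cokerRefl hi hlam).obj V ⟶ W) {j : I} (hj : j ≠ i) (x : V.obj j) :
    W.kerNe hi hlam' j hj ((toKer hi hlam hlam' g).app j x) =
      g.app j ((V.cokerNe hi hlam j hj).symm x) := by
  rw [toKer, homMk_app_of_ne _ _ _ _ _ _ hj]
  exact LinearEquiv.apply_symm_apply _ _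

/-- The map `V_⊕ → W_⊕` of a morphism `V → K_i(W)`. -/
def toKerOplus (h : V ⟶ (kerRefl hi hlam').obj W) : V.Oplus i →ₗ[K] W.Oplus i :=
  (W.kerOplus hi hlam').toLinearMap ∘ₗ oplusMap h i

/-- The μ of K_i(W) is the inclusion of Ker π. Hence π f_⊕ kills the image of μ and descends to
Coker μ, which gives the component at `i` of `fromCoker`. -/
theorem toKerOplus_mu (h : V ⟶ (kerRefl hi hlam').obj W) (x : V.obj i) :
    toKerOplus hi hlam' h (V.mu i x) = (W.kerAt hi hlam' (h.app i x)).1 := by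
  rw [toKerOplus, LinearMap.comp_apply, ← mu_app]
  exact kerOplus_mu W hi hlam' _

/-- The converse of `fromCokerOplus_theta`: compatibility of h with π reads f_⊕ μπ = (μπ - λ'_i)
f_⊕, and λ'_i = -λ_i moves the scalar back to the side of V. -/
theorem toKerOplus_theta (hlam : lam' = reflWeight i lam) (h : V ⟶ (kerRefl hi hlam').obj W)
    (x : V.Oplus i) :
    toKerOplus hi hlam' h (V.theta i x) = W.mu i (W.pi i (toKerOplus hi hlam' h x)) := by
  have h1 : toKerOplus hi hlam' h (V.mu i (V.pi i x)) =
      W.mu i (W.pi i (toKerOplus hi hlam' h x)) - lam' i • toKerOplus hi hlam' h x := by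
    rw [toKerOplus_mu, app_pi, kerAt_pi, kerGamma_coe]
    rfl
  rw [theta, LinearMap.sub_apply, map_sub, LinearMap.comp_apply, h1, weight_at hi hlam]
  simp

/-- The morphism `C_i(V) → W` attached to a morphism `V → K_i(W)`. -/
def fromCoker (h : V ⟶ (kerRefl hi hlam').obj W) : (cokerRefl hi hlam).obj V ⟶ W :=
  homMk hi
    ((LinearMap.range (V.mu i)).liftQ (W.pi i ∘ₗ toKerOplus hi hlam' h)
      (LinearMap.range_le_ker_iff.2 (LinearMap.ext fun x => by
        rw [LinearMap.comp_apply, LinearMap.comp_apply, toKerOplus_mu]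
        exact (W.kerAt hi hlam' (h.app i x)).2)) ∘ₗ (V.cokerAt hi hlam).toLinearMap)
    (fun j hj => (W.kerNe hi hlam' j hj).toLinearMap ∘ₗ h.app j ∘ₗ
      (V.cokerNe hi hlam j hj).toLinearMap)
    (fun j k hj hk a x => by
      simp only [LinearMap.comp_apply, LinearEquiv.coe_coe]
      rw [cokerNe_map V hi hlam hj hk, comm_apply h, kerNe_map W hi hlam' hj hk])
    (fun x => by
      -- With y a lift along c of the component at `i`, γ c = θ turns the claim into
      -- `toKerOplus_theta` at y.
      obtain ⟨y, hy⟩ := V.cokerC_surjective (V.cokerAt hi hlam x)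
      have h2 := V.cokerOplus_mu hi hlam x
      rw [← hy] at h2
      rw [LinearMap.comp_apply, LinearEquiv.coe_coe, ← hy]
      refine (toKerOplus_theta hi hlam' hlam h y).symm.trans ?_
      rw [← cokerGamma_c, LinearMap.comp_apply, ← h2]
      rfl)
    (fun x => by
      rw [LinearMap.comp_apply, LinearEquiv.coe_coe, cokerAt_pi]
      rfl)

theorem fromCoker_app (h : V ⟶ (kerRefl hi hlam').obj W) {j : I} (hj : j ≠ i)
    (x : ((cokerRefl hi hlam).obj V).obj j) :
    (fromCoker hi hlam hlam' h).app j x =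
      W.kerNe hi hlam' j hj (h.app j (V.cokerNe hi hlam j hj x)) := by
  rw [fromCoker, homMk_app_of_ne _ _ _ _ _ _ hj]
  rfl

theorem fromCoker_app_self (h : V ⟶ (kerRefl hi hlam').obj W) (y : V.Oplus i) :
    (fromCoker hi hlam hlam' h).app i ((V.cokerAt hi hlam).symm (V.cokerC i y)) =
      W.pi i (toKerOplus hi hlam' h y) := by
  rw [fromCoker, homMk_app_self, LinearMap.comp_apply, LinearEquiv.coe_coe,
    LinearEquiv.apply_symm_apply]
  rfl

end homEquiv

variable (hi : LoopFree i) (hlam : lam' = reflWeight i lam) (hlam' : lam = reflWeight i lam')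

/-- Morphisms `C_i(V) → W` are the same as morphisms `V → K_i(W)`. -/
def cokerKerEquiv (V : Rep lam) (W : Rep lam') :
    ((cokerRefl hi hlam).obj V ⟶ W) ≃ (V ⟶ (kerRefl hi hlam').obj W) where
  toFun := toKer hi hlam hlam'
  invFun := fromCoker hi hlam hlam'
  left_inv g := by
    refine hom_ext_of_pi_surjective hi (V.pi_cokerRefl_surjective hi hlam) fun j hj =>
      LinearMap.ext fun x => ?_
    rw [fromCoker_app _ _ _ _ hj, toKer_app, LinearEquiv.symm_apply_apply]
  right_inv h := by
    refine hom_ext_of_mu_injective hi (W.mu_kerRefl_injective hi hlam') fun j hj =>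
      LinearMap.ext fun x => (W.kerNe hi hlam' j hj).injective ?_
    rw [toKer_app, fromCoker_app _ _ _ _ hj, LinearEquiv.apply_symm_apply]

/-- `C_i` is left adjoint to `K_i` on representations. -/
def cokerKerAdjunction : cokerRefl hi hlam ⊣ kerRefl hi hlam' :=
  Adjunction.mkOfHomEquiv
    { homEquiv := cokerKerEquiv hi hlam hlam'
      homEquiv_naturality_left_symm := fun {V' V W} f g => by
        refine hom_ext_of_pi_surjective hi (V'.pi_cokerRefl_surjective hi hlam) fun j hj =>
          LinearMap.ext fun x => ?_
        refine (fromCoker_app hi hlam hlam' _ hj x).trans ?_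
        refine Eq.trans ?_ (fromCoker_app hi hlam hlam' g hj _).symm
        rw [cokerNe_cokerRefl_map]
        rfl
      homEquiv_naturality_right := fun {V W W'} f g => by
        refine hom_ext_of_mu_injective hi (W'.mu_kerRefl_injective hi hlam') fun j hj =>
          LinearMap.ext fun x => (W'.kerNe hi hlam' j hj).injective ?_
        refine (toKer_app hi hlam hlam' _ hj x).trans ?_
        rw [comp_app, comp_app, LinearMap.comp_apply, LinearMap.comp_apply, kerNe_kerRefl_map]
        exact congrArg (g.app j) (toKer_app hi hlam hlam' f hj x).symm }

theorem cokerKerAdjunction_counit (W : Rep lam') :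
    (cokerKerAdjunction hi hlam hlam').counit.app W =
      fromCoker hi hlam hlam' (𝟙 ((kerRefl hi hlam').obj W)) := by
  simp [cokerKerAdjunction, cokerKerEquiv]

end Rep

namespace Rep

variable {lam lam' : I → K} {i : I}

/-! ### The case of a nonzero weight at `i` -/

theorem replApp_bijective (V : Rep lam) {X Y : Type u} [AddCommGroup X] [Module K X]
    [AddCommGroup Y] [Module K Y] (g : X →ₗ[K] Y) (hg : Function.Bijective g) (j : I)
    (d : Decidable (j = i)) : Function.Bijective (replApp (𝟙 V) g j d) := by
  rcases d with h | h
  · exact Function.bijective_id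
  · exact hg

/-- The map `Coker μ → Ker π` induced by `μ π - λ_i`. -/
def cokerToKer (V : Rep lam) (i : I) : V.Coker i →ₗ[K] V.Ker i :=
  (LinearMap.range (V.mu i)).liftQ (V.kerGamma i)
    (LinearMap.range_le_ker_iff.2 (LinearMap.ext fun x =>
      Subtype.ext (LinearMap.congr_fun (V.theta_mu i) x)))

theorem cokerToKer_c (V : Rep lam) (x : V.Oplus i) :
    V.cokerToKer i (V.cokerC i x) = V.kerGamma i x := rfl

/-- The inverse is -λ_i⁻¹ c ι: if θ y = 0 then y = μ(λ_i⁻¹ π y) vanishes in Coker μ, and θ is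
multiplication by -λ_i on Ker π. -/
theorem cokerToKer_bijective (V : Rep lam) (h0 : lam i ≠ 0) :
    Function.Bijective (V.cokerToKer i) := by
  constructor
  · rw [injective_iff_map_eq_zero]
    intro x hx
    obtain ⟨y, rfl⟩ := V.cokerC_surjective x
    rw [cokerToKer_c] at hx
    have h1 : V.mu i (V.pi i y) - lam i • y = 0 := congrArg Subtype.val hx
    have h2 : y = V.mu i ((lam i)⁻¹ • V.pi i y) := by
      rw [map_smul, sub_eq_zero.1 h1, smul_smul, inv_mul_cancel₀ h0, one_smul]
    rw [h2]
    exact LinearMap.congr_fun (V.c_mu i) _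
  · intro x
    refine ⟨V.cokerC i (-(lam i)⁻¹ • x.1), ?_⟩
    rw [map_smul, map_smul, cokerToKer_c]
    have h : V.kerGamma i x.1 = -lam i • x := LinearMap.congr_fun (V.kerGamma_iota i) x
    rw [h, smul_smul, neg_mul_neg, inv_mul_cancel₀ h0, one_smul]

theorem pi_idem (V : Rep lam) (h0 : lam i ≠ 0) (x : V.Oplus i) : V.pi i (V.idem i x) = 0 := by
  rw [idem, LinearMap.sub_apply, map_sub, LinearMap.smul_apply, map_smul, LinearMap.comp_apply,
    pi_mu_apply, smul_smul, inv_mul_cancel₀ h0, one_smul, LinearMap.id_apply, sub_self]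

/-- The image of the idempotent `1 - λ_i⁻¹ μ π` is contained in `Ker π`. -/
def cbhToKer (V : Rep lam) (h0 : lam i ≠ 0) : V.CBHSpace i →ₗ[K] V.Ker i :=
  Submodule.inclusion (by
    rintro _ ⟨x, rfl⟩
    exact V.pi_idem h0 x)

/-- The idempotent 1 - λ_i⁻¹μπ is the identity on Ker π, so its image is all of Ker π. -/
theorem cbhToKer_bijective (V : Rep lam) (h0 : lam i ≠ 0) :
    Function.Bijective (V.cbhToKer h0) := by
  refine ⟨Submodule.inclusion_injective _, fun x => ?_⟩
  refine ⟨⟨x.1, x.1, ?_⟩, rfl⟩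
  rw [idem, LinearMap.sub_apply, LinearMap.smul_apply, LinearMap.comp_apply,
    show V.pi i x.1 = 0 from x.2, map_zero, smul_zero, sub_zero, LinearMap.id_apply]

variable (hi : LoopFree i) (hlam : lam' = reflWeight i lam)

/-- The natural morphism `C_i(V) → K_i(V)`. -/
def cokerReflToKerRefl (V : Rep lam) : (cokerRefl hi hlam).obj V ⟶ (kerRefl hi hlam).obj V :=
  reflectMap (hi := hi) (hlam := hlam) (hqp := V.cokerGamma_c i) (hpq := V.coker_c_gamma i)
    (hqp' := V.iota_kerGamma i) (hpq' := V.kerGamma_iota i)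
    (𝟙 V) (V.cokerToKer i) (LinearMap.ext fun _ => rfl)
    (Submodule.linearMap_qext _ (LinearMap.ext fun _ => rfl))

theorem kerNe_cokerReflToKerRefl (V : Rep lam) {j : I} (hj : j ≠ i)
    (x : ((cokerRefl hi hlam).obj V).obj j) :
    V.kerNe hi hlam j hj ((cokerReflToKerRefl hi hlam V).app j x) = V.cokerNe hi hlam j hj x :=
  replApp_ne (𝟙 V) (V.cokerToKer i) j hj _ x

/-- `C_i ≅ K_i` if `λ_i ≠ 0`. -/
def cokerReflIsoKerRefl (h0 : lam i ≠ 0) : cokerRefl hi hlam ≅ kerRefl hi hlam :=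
  haveI : ∀ V : Rep lam, IsIso (cokerReflToKerRefl hi hlam V) := fun V =>
    isIso_of_bijective _ fun j => V.replApp_bijective _ (V.cokerToKer_bijective h0) j _
  NatIso.ofComponents (fun V => asIso (cokerReflToKerRefl hi hlam V)) fun {U V} f => by
    -- Naturality at `i` is automatic, the target being of the form K_i(V).
    refine hom_ext_of_mu_injective hi (V.mu_kerRefl_injective hi hlam) fun j hj =>
      LinearMap.ext fun x => (V.kerNe hi hlam j hj).injective ?_
    simp only [asIso_hom, comp_app, LinearMap.comp_apply]
    rw [kerNe_cokerReflToKerRefl, cokerNe_cokerRefl_map, kerNe_kerRefl_map,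
      kerNe_cokerReflToKerRefl]

/-- The natural morphism `E_i(V) → K_i(V)`. -/
def cbhReflToKerRefl (h0 : lam i ≠ 0) (V : Rep lam) :
    (cbhRefl hi hlam h0).obj V ⟶ (kerRefl hi hlam).obj V :=
  reflectMap (hi := hi) (hlam := hlam) (hqp := V.cbhIncl_proj i h0) (hpq := V.cbhProj_incl i h0)
    (hqp' := V.iota_kerGamma i) (hpq' := V.kerGamma_iota i)
    (𝟙 V) (V.cbhToKer h0)
    (LinearMap.ext fun x => Subtype.ext (LinearMap.congr_fun (V.smul_idem i h0) x))
    (LinearMap.ext fun _ => rfl)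

/-- `K_i ≅ E_i` if `λ_i ≠ 0`. -/
def kerReflIsoCbhRefl (h0 : lam i ≠ 0) : kerRefl hi hlam ≅ cbhRefl hi hlam h0 :=
  haveI : ∀ V : Rep lam, IsIso (cbhReflToKerRefl hi hlam h0 V) := fun V =>
    isIso_of_bijective _ fun j => V.replApp_bijective _ (V.cbhToKer_bijective h0) j _
  (NatIso.ofComponents (fun V => asIso (cbhReflToKerRefl hi hlam h0 V)) fun {U V} f => by
    refine hom_ext_of_mu_injective hi (V.mu_kerRefl_injective hi hlam) fun j hj =>
      LinearMap.ext fun x => (V.kerNe hi hlam j hj).injective ?_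
    simp only [asIso_hom, comp_app, LinearMap.comp_apply]
    rw [kerNe_kerRefl_map]
    refine (replApp_ne (𝟙 V) (V.cbhToKer h0) j hj _ _).trans ?_
    refine (replApp_ne f (cbhMap i f) j hj _ _).trans ?_
    exact congrArg (f.app j) (replApp_ne (𝟙 U) (U.cbhToKer h0) j hj _ x).symm).symm

variable (hlam' : lam = reflWeight i lam')

/-- For V = K_i(W) the cokernel of μ is W_⊕/Ker π, and at `i` the counit is the map to W_i induced
by π. It is injective for every weight; it is onto because π(μ(x/λ'_i)) = x. Away from `i` it is a
composite of identifications. -/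
theorem isIso_counit (h0 : lam' i ≠ 0) (W : Rep lam') :
    IsIso ((cokerKerAdjunction hi hlam hlam').counit.app W) := by
  rw [cokerKerAdjunction_counit]
  refine isIso_of_bijective _ fun j => ?_
  by_cases hj : j = i
  · subst hj
    set V := (kerRefl hi hlam').obj W with hV
    have key : ∀ y, (fromCoker hi hlam hlam' (𝟙 V)).app j
        ((V.cokerAt hi hlam).symm (V.cokerC j y)) = W.pi j (W.kerOplus hi hlam' y) :=
      fun y => fromCoker_app_self hi hlam hlam' (𝟙 V) y
    constructor
    · rw [injective_iff_map_eq_zero]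
      intro x hx
      obtain ⟨y, hy⟩ := V.cokerC_surjective (V.cokerAt hi hlam x)
      obtain rfl : (V.cokerAt hi hlam).symm (V.cokerC j y) = x := by
        rw [hy, LinearEquiv.symm_apply_apply]
      have hy' : W.pi j (W.kerOplus hi hlam' y) = 0 := (key y).symm.trans hx
      have h : y = V.mu j ((W.kerAt hi hlam').symm ⟨W.kerOplus hi hlam' y, hy'⟩) := by
        refine (W.kerOplus hi hlam').injective ?_
        rw [kerOplus_mu, LinearEquiv.apply_symm_apply]
      have h' : V.cokerC j y = 0 := by
        rw [h]
        exact LinearMap.congr_fun (V.c_mu j) _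
      rw [h', map_zero]
    · intro x
      refine ⟨_, (key ((W.kerOplus hi hlam').symm (W.mu j ((lam' j)⁻¹ • x)))).trans ?_⟩
      rw [LinearEquiv.apply_symm_apply, pi_mu_apply, smul_smul, mul_inv_cancel₀ h0, one_smul]
  · have h : ⇑((fromCoker hi hlam hlam' (𝟙 ((kerRefl hi hlam').obj W))).app j) =
        (((kerRefl hi hlam').obj W).cokerNe hi hlam j hj).trans (W.kerNe hi hlam' j hj) :=
      funext fun x => fromCoker_app hi hlam hlam' _ hj x
    rw [h]
    exact LinearEquiv.bijective _

/-- `C_i C_i ≅ id` if `λ_i ≠ 0`. -/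
def cokerReflCompIso (h0 : lam i ≠ 0) : cokerRefl hi hlam ⋙ cokerRefl hi hlam' ≅ 𝟭 (Rep lam) :=
  haveI : ∀ V : Rep lam, IsIso ((cokerKerAdjunction hi hlam' hlam).counit.app V) :=
    isIso_counit hi hlam' hlam h0
  haveI : IsIso (cokerKerAdjunction hi hlam' hlam).counit := NatIso.isIso_of_isIso_app _
  -- The first C_i is replaced by K_i; what remains is the source of the counit of C_i ⊣ K_i.
  Functor.isoWhiskerRight (cokerReflIsoKerRefl hi hlam h0) _ ≪≫
    asIso (cokerKerAdjunction hi hlam' hlam).counit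

end Rep

/-! ### Transport of the adjunction and the equivalence to modules -/

section modules

variable {lam lam' : I → K} {i : I} (hi : LoopFree i) (hlam : lam' = reflWeight i lam)
  (hlam' : lam = reflWeight i lam')

/-- `C_i` is left adjoint to `K_i` on modules. -/
def cokerKerFunctorAdjunction : cokerFunctor hi hlam ⊣ kerFunctor hi hlam' :=
  ((modToRep lam).asEquivalence.toAdjunction.comp (Rep.cokerKerAdjunction hi hlam hlam')).comp
    (modToRep lam').asEquivalence.symm.toAdjunction

/-- `C_i C_i ≅ id` on modules if `λ_i ≠ 0`. -/
def cokerFunctorCompIso (h0 : lam i ≠ 0) :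
    cokerFunctor hi hlam ⋙ cokerFunctor hi hlam' ≅ 𝟭 (ModuleCat.{u} (DPA lam)) :=
  -- The equivalence for `lam'` cancels in the middle, then C_i C_i ≅ id on representations applies,
  -- and last the equivalence for `lam` cancels.
  Functor.isoWhiskerLeft (modToRep lam ⋙ Rep.cokerRefl hi hlam)
      (Functor.isoWhiskerRight (modToRep lam').asEquivalence.counitIso
        (Rep.cokerRefl hi hlam' ⋙ (modToRep lam).inv)) ≪≫
    Functor.isoWhiskerLeft (modToRep lam) (Functor.isoWhiskerRight
      (Rep.cokerReflCompIso hi hlam hlam' h0) (modToRep lam).inv) ≪≫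
    (modToRep lam).asEquivalence.unitIso.symm

/-- The reflected weight at `i` is -λ_i, again nonzero, so `cokerFunctorCompIso` applies to both
composites. -/
theorem isEquivalence_cokerFunctor (hlam' : lam = reflWeight i lam') (h0 : lam i ≠ 0) :
    (cokerFunctor hi hlam).IsEquivalence := by
  have h0' : lam' i ≠ 0 := by rw [Rep.weight_at hi hlam]; exact neg_ne_zero.2 h0
  exact (CategoryTheory.Equivalence.mk (cokerFunctor hi hlam) (cokerFunctor hi hlam')
    (cokerFunctorCompIso hi hlam hlam' h0).symm
    (cokerFunctorCompIso hi hlam' hlam h0')).isEquivalence_functor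

end modules

/-! ### Tensor-hom adjunction for a two-sided ideal -/
section TensorHom
open scoped TensorProduct

variable {A : Type u} [Ring A] (J : Ideal A) [J.IsTwoSided]

/-- The class of `x ⊗ m` in `J ⊗_A M`. -/
def idealTmul {M : Type u} [AddCommGroup M] [Module A M] (x : J) (m : M) : IdealTensor J M :=
  (balanced J M).mkQ (x ⊗ₜ[ℤ] m)

section
variable {M : Type u} [AddCommGroup M] [Module A M]

theorem idealTmul_add (x : J) (m n : M) :
    idealTmul J x (m + n) = idealTmul J x m + idealTmul J x n := by
  simp only [idealTmul, TensorProduct.tmul_add, map_add]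

theorem add_idealTmul (x y : J) (m : M) :
    idealTmul J (x + y) m = idealTmul J x m + idealTmul J y m := by
  simp only [idealTmul, TensorProduct.add_tmul, map_add]

theorem smul_idealTmul (a : A) (x : J) (m : M) :
    idealTmul J (a • x) m = a • idealTmul J x m := by
  rw [idealTmul, idealTmul, ← map_smul]
  rfl

theorem idealTmul_smul (a : A) (x : J) (m : M) :
    idealTmul J x (a • m) = idealTmul J (rmul J a x) m := by
  rw [idealTmul, idealTmul, eq_comm, ← sub_eq_zero, ← map_sub]
  exact (Submodule.Quotient.mk_eq_zero _).2 (Submodule.subset_span ⟨x, a, m, rfl⟩)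

variable {J} in
theorem idealTensor_hom_ext {N : Type u} [AddCommGroup N] [Module A N]
    {f g : IdealTensor J M →ₗ[A] N} (h : ∀ x m, f (idealTmul J x m) = g (idealTmul J x m)) :
    f = g :=
  Submodule.linearMap_qext _ (TensorProduct.AlgebraTensorModule.ext h)

variable {N : Type u} [AddCommGroup N] [Module A N]

/-- The map `M → Hom_A(J, N)` attached to `J ⊗_A M → N`. -/
def idealCurry (f : IdealTensor J M →ₗ[A] N) : M →ₗ[A] IdealHom J N where
  toFun m :=
    ({ toFun := fun x => f (idealTmul J x m)
       map_add' := fun x y => by rw [add_idealTmul, map_add]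
       map_smul' := fun a x => by rw [smul_idealTmul, map_smul]; rfl } : J →ₗ[A] N)
  map_add' m n := LinearMap.ext fun x =>
    (congrArg f (idealTmul_add J x m n)).trans (map_add f _ _)
  map_smul' a m := LinearMap.ext fun x => congrArg f (idealTmul_smul J a x m)

/-- The map `J ⊗_A M → N` attached to `M → Hom_A(J, N)`. -/
def idealUncurry (h : M →ₗ[A] IdealHom J N) : IdealTensor J M →ₗ[A] N :=
  (balanced J M).liftQ
    (TensorProduct.AlgebraTensorModule.lift
      { toFun := fun x =>
          ({ toFun := fun m => (h m).lin x
             map_zero' := by rw [map_zero]; rfl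
             map_add' := fun m n => by rw [map_add]; rfl } : M →+ N).toIntLinearMap
        map_add' := fun x y => LinearMap.ext fun m => map_add (h m).lin x y
        map_smul' := fun a x => LinearMap.ext fun m => map_smul (h m).lin a x }) <| by
    rw [balanced, Submodule.span_le]
    rintro _ ⟨x, a, m, rfl⟩
    rw [SetLike.mem_coe, LinearMap.mem_ker, map_sub, sub_eq_zero]
    -- Balancedness is the linearity of h, because a acts on Hom_A(J, N) by (aφ)(x) = φ(x a).
    change (h m).lin (rmul J a x) = (h (a • m)).lin x
    rw [map_smul]
    rfl

end

/-- `J ⊗_A -` is left adjoint to `Hom_A(J, -)`. -/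
def tensorHomAdjunction : tensorFunctor J ⊣ homFunctor J :=
  Adjunction.mkOfHomEquiv
    { homEquiv := fun _ _ =>
        { toFun := fun f => ModuleCat.ofHom (idealCurry J f.hom)
          invFun := fun h => ModuleCat.ofHom (idealUncurry J h.hom)
          left_inv := fun _ => ModuleCat.hom_ext (idealTensor_hom_ext fun _ _ => rfl)
          right_inv := fun _ => rfl }
      homEquiv_naturality_left_symm := fun _ _ =>
        ModuleCat.hom_ext (idealTensor_hom_ext fun _ _ => rfl)
      homEquiv_naturality_right := fun _ _ => rfl }

end TensorHom

/-! ### Elements of the ideal I_i and generators of I_i e_i -/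

section ideal

variable (lam : I → K) (i : I) (h0 : lam i = 0)

theorem mem_trivialIdeal {x : DPA lam} :
    x ∈ trivialIdeal lam i h0 ↔ (simpleRep lam i h0).actHom x = 0 := by
  rw [trivialIdeal, Module.mem_annihilator]
  exact ⟨fun h => LinearMap.ext h, fun h v => LinearMap.congr_fun h v⟩

theorem arr_mem_trivialIdeal {j k : I} (a : DArrow j k) :
    DPA.arr lam a ∈ trivialIdeal lam i h0 := by
  rw [mem_trivialIdeal, Rep.actHom_arr, show (simpleRep lam i h0).map a = 0 from rfl,
    LinearMap.zero_comp, LinearMap.comp_zero]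

theorem e_mem_trivialIdeal {j : I} (hj : j ≠ i) : DPA.e lam j ∈ trivialIdeal lam i h0 := by
  rw [mem_trivialIdeal, Rep.actHom_e]
  refine LinearMap.ext fun v => ?_
  have h : (simpleRep lam i h0).proj j v = 0 :=
    (Rep.replNe (K := K) K (fun _ : I => PUnit.{u + 1}) _ hj).injective (Subsingleton.elim _ _)
  rw [LinearMap.comp_apply, h, map_zero, LinearMap.zero_apply]

/-- The space of `S_i` at `i` is `K`. -/
def simpleAt : (simpleRep lam i h0).obj i ≃ₗ[K] K :=
  Rep.replAt K (fun _ : I => PUnit.{u + 1}) (inferInstance : Decidable (i = i)) rfl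

/-- The element c e_i acts on the generator of S_i as the scalar c. -/
theorem eq_zero_of_smul_e_mem {c : K} (h : c • DPA.e lam i ∈ trivialIdeal lam i h0) : c = 0 := by
  rw [mem_trivialIdeal, map_smul, Rep.actHom_e] at h
  have h1 := LinearMap.congr_fun h ((simpleRep lam i h0).incl i ((simpleAt lam i h0).symm 1))
  have h2 := congrArg (fun v => simpleAt lam i h0 ((simpleRep lam i h0).proj i v)) h1
  have h3 : ∀ x, (simpleRep lam i h0).proj i ((simpleRep lam i h0).incl i x) = x :=
    LinearMap.congr_fun ((simpleRep lam i h0).proj_incl i)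
  simp only [LinearMap.smul_apply, LinearMap.comp_apply, LinearMap.zero_apply, map_smul, h3,
    map_zero, LinearEquiv.apply_symm_apply] at h2
  simpa using h2

theorem arr_mul_e_of_ne {j k : I} (a : DArrow j k) (h : j ≠ i) :
    DPA.arr lam a * DPA.e lam i = 0 := by
  rw [← DPA.arr_mul_e, mul_assoc, DPA.e_mul_e_of_ne lam h, mul_zero]

/-- Π e_i is spanned by the paths starting at `i`, and a nontrivial one begins with an arrow leaving
`i`, that is, with b* for some b with head `i`. The induction multiplies on the left by one arrow at
a time. -/
theorem exists_mul_e_eq (x : DPA lam) :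
    ∃ (c : K) (y : (Σ j : I, DArrow j i) → DPA lam),
      x * DPA.e lam i = c • DPA.e lam i + ∑ b, y b * DPA.arr lam b.2.star := by
  classical
  refine DPA.induction_on lam (P := fun x => ∃ (c : K) (y : (Σ j : I, DArrow j i) → DPA lam),
      x * DPA.e lam i = c • DPA.e lam i + ∑ b, y b * DPA.arr lam b.2.star) x ?_ ?_ ?_ ?_ ?_
  · rintro x x' ⟨c, y, h⟩ ⟨c', y', h'⟩
    refine ⟨c + c', y + y', ?_⟩
    simp only [add_mul, h, h', add_smul, Pi.add_apply, Finset.sum_add_distrib]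
    abel
  · rintro d x ⟨c, y, h⟩
    refine ⟨d * c, d • y, ?_⟩
    simp only [smul_mul_assoc, h, smul_add, mul_smul, Pi.smul_apply, Finset.smul_sum]
  · intro j
    by_cases hj : j = i
    · subst hj
      exact ⟨1, 0, by simp [DPA.e_mul_e]⟩
    · exact ⟨0, 0, by simp [DPA.e_mul_e_of_ne lam hj]⟩
  · rintro j k a x ⟨c, y, h⟩
    by_cases hj : j = i
    · subst hj
      -- Multiplying c e_i by an arrow a leaving `i` gives c a, which contributes c to the
      -- coefficient at b = a*, since (a*)* = a.
      refine ⟨0, fun b => DPA.arr lam a * y b + if b = ⟨k, a.star⟩ then algebraMap K _ c else 0, ?_⟩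
      have h1 : ∑ b : (Σ l : I, DArrow l j),
          (if b = ⟨k, a.star⟩ then algebraMap K (DPA lam) c else 0) * DPA.arr lam b.2.star =
          c • DPA.arr lam a := by
        simp only [ite_mul, zero_mul, Finset.sum_ite_eq', Finset.mem_univ, if_true,
          Rep.star_star, Algebra.smul_def]
      simp only [add_mul, Finset.sum_add_distrib, h1]
      rw [mul_assoc, h, mul_add, mul_smul_comm, DPA.arr_mul_e, Finset.mul_sum, zero_smul, zero_add,
        add_comm]
      simp only [mul_assoc]
    · refine ⟨0, fun b => DPA.arr lam a * y b, ?_⟩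
      simp only [mul_assoc, h, mul_add, Finset.mul_sum, zero_smul, zero_add, mul_smul_comm,
        arr_mul_e_of_ne lam i a hj, smul_zero]
  · exact ⟨0, 0, by simp⟩

/-- All arrows lie in I_i, so the term c e_i does too, and then c = 0. Thus I_i e_i is the left
ideal generated by the arrows leaving `i`; this makes `evalStar` injective. -/
theorem exists_mul_e_eq_of_mem {x : DPA lam} (hx : x ∈ trivialIdeal lam i h0) :
    ∃ y : (Σ j : I, DArrow j i) → DPA lam,
      x * DPA.e lam i = ∑ b, y b * DPA.arr lam b.2.star := by
  obtain ⟨c, y, h⟩ := exists_mul_e_eq lam i x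
  have hc : c • DPA.e lam i ∈ trivialIdeal lam i h0 := by
    rw [eq_sub_of_add_eq h.symm]
    exact sub_mem (Ideal.mul_mem_right _ _ hx) (sum_mem fun b _ =>
      Ideal.mul_mem_left _ _ (arr_mem_trivialIdeal lam i h0 _))
  rw [eq_zero_of_smul_e_mem lam i h0 hc, zero_smul, zero_add] at h
  exact ⟨y, h⟩

end ideal

/-! ### Extensions of S_i by V attached to elements of Ker π -/

namespace Rep
variable {lam : I → K} {i : I}

instance (V : Rep lam) : IsScalarTower K (DPA lam) V.total :=
  ⟨fun c x v => by
    rw [smul_total, smul_total, map_smul, LinearMap.smul_apply]⟩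

theorem incl_self_apply (V : Rep lam) (j : I) (x : V.obj j) : V.incl j x j = x :=
  LinearMap.congr_fun (V.proj_incl j) x

theorem incl_ne_apply (V : Rep lam) {j k : I} (h : k ≠ j) (x : V.obj j) : V.incl j x k = 0 :=
  LinearMap.congr_fun (V.proj_incl_of_ne h) x

theorem e_smul (V : Rep lam) (j : I) (v : V.total) : DPA.e lam j • v = V.incl j (v j) := by
  rw [smul_total, actHom_e]; rfl

theorem arr_smul (V : Rep lam) {j k : I} (a : DArrow j k) (v : V.total) :
    DPA.arr lam a • v = V.incl k (V.map a (v j)) := by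
  rw [smul_total, actHom_arr]; rfl

theorem incl_app {U V : Rep lam} (f : U ⟶ V) (j k : I) (x : U.obj j) :
    f.app k (U.incl j x k) = V.incl j (f.app j x) k := by
  by_cases h : k = j
  · subst h
    rw [incl_self_apply, incl_self_apply]
  · rw [incl_ne_apply _ h, incl_ne_apply _ h, map_zero]

/-- The module homomorphism of a morphism of representations. -/
def totalMap {U V : Rep lam} (f : U ⟶ V) : U.total →ₗ[DPA lam] V.total :=
  let F : U.total →ₗ[K] V.total := LinearMap.piMap (fun j => f.app j)
  { F with
    map_smul' := linear_of_gen F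
      (fun j v => by
        rw [e_smul, e_smul]
        exact funext fun k => incl_app f j k _)
      (fun {j k} a v => by
        rw [arr_smul, arr_smul]
        refine funext fun l => (incl_app f k l _).trans ?_
        rw [comm_apply]
        rfl) }

section extension

variable (V : Rep lam) (h0 : lam i = 0) (m : V.Ker i)

/-- The map `s ↦ s m_{a*}` from the simple representation `S_i`, on an arrow `a` with tail `i`. -/
def extArrow {j k : I} (a : DArrow j k) : (simpleRep lam i h0).obj j →ₗ[K] V.obj k :=
  if h : j = i then by
    subst h
    exact (simpleAt lam j h0).toLinearMap.smulRight (V.prj a.star m.1)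
  else 0

theorem extArrow_self {k : I} (a : DArrow i k) (s : (simpleRep lam i h0).obj i) :
    V.extArrow h0 m a s = simpleAt lam i h0 s • V.prj a.star m.1 := by
  rw [extArrow, dif_pos rfl]; rfl

theorem pi_apply (x : V.Oplus i) :
    V.pi i x = ∑ j : I, ∑ a : DArrow j i, eps K a • V.map a (V.prj a x) := by
  rw [Rep.pi]
  simp only [LinearMap.sum_apply, LinearMap.smul_apply, LinearMap.comp_apply]

/-- This is the off-diagonal term of the relation for the extension. At `i` it equals s π(m), which
vanishes because m ∈ Ker π; at other vertices S_i is zero. -/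
theorem sum_map_extArrow (k : I) (s : (simpleRep lam i h0).obj k) :
    ∑ j : I, ∑ a : DArrow j k, eps K a • V.map a (V.extArrow h0 m a.star s) = 0 := by
  by_cases hk : k = i
  · subst hk
    have h : V.pi k (simpleAt lam k h0 s • m.1) = 0 := by
      rw [map_smul, show V.pi k m.1 = 0 from m.2, smul_zero]
    rw [← h, pi_apply]
    refine Finset.sum_congr rfl fun j _ => Finset.sum_congr rfl fun a _ => ?_
    rw [extArrow_self, star_star, map_smul (V.prj a)]
  · refine Finset.sum_eq_zero fun j _ => Finset.sum_eq_zero fun a _ => ?_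
    rw [extArrow, dif_neg hk, LinearMap.zero_apply, map_zero, smul_zero]

/-- The extension of `S_i` by `V` attached to an element of `Ker π`. -/
def extension : Rep lam where
  obj j := V.obj j × (simpleRep lam i h0).obj j
  map {j k} a := (V.map a ∘ₗ LinearMap.fst K _ _ + V.extArrow h0 m a ∘ₗ LinearMap.snd K _ _).prod 0
  rel k := by
    refine LinearMap.ext fun x => ?_
    simp only [LinearMap.sum_apply, LinearMap.smul_apply, LinearMap.comp_apply]
    refine Prod.ext ?_ ?_
    · have h : ∀ (j : I) (a : DArrow j k),
          V.map a (V.map a.star x.1 + V.extArrow h0 m a.star x.2) + V.extArrow h0 m a 0 =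
            V.map a (V.map a.star x.1) + V.map a (V.extArrow h0 m a.star x.2) := by
        intro j a
        rw [map_add, map_zero, add_zero]
      have h1 := LinearMap.congr_fun (V.rel k) x.1
      simp only [LinearMap.sum_apply, LinearMap.smul_apply, LinearMap.comp_apply] at h1
      simp only [Prod.fst_sum]
      change ∑ j : I, ∑ a : DArrow j k, eps K a •
        (V.map a (V.map a.star x.1 + V.extArrow h0 m a.star x.2) + V.extArrow h0 m a 0) =
          lam k • x.1
      simp only [h, smul_add, Finset.sum_add_distrib]
      rw [sum_map_extArrow, add_zero]
      exact h1
    · have h1 := LinearMap.congr_fun ((simpleRep lam i h0).rel k) x.2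
      simp only [LinearMap.sum_apply, LinearMap.smul_apply] at h1
      simp only [Prod.snd_sum]
      exact h1

/-- The inclusion of `V` in the extension. -/
def extInl : V ⟶ V.extension h0 m where
  app _ := LinearMap.inl K _ _
  comm a := LinearMap.ext fun x => by
    refine Prod.ext ?_ rfl
    change V.map a x = V.map a x + V.extArrow h0 m a 0
    rw [map_zero, add_zero]

/-- The projection of the extension to `S_i`. -/
def extSnd : V.extension h0 m ⟶ simpleRep lam i h0 where
  app _ := LinearMap.snd K _ _
  comm _ := rfl

/-- The lift to the extension of the generator of `S_i`. -/
def extGenAt : (V.extension h0 m).obj i := (0, (simpleAt lam i h0).symm 1)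

/-- The lift to the extension of the generator of `S_i`, as an element of the module. -/
def extGen : (V.extension h0 m).total := (V.extension h0 m).incl i (V.extGenAt h0 m)

/-- The projection of the extension to `V`, as a map of groups. -/
def extFst : (V.extension h0 m).total →+ V.total where
  toFun w j := (w j).1
  map_zero' := rfl
  map_add' _ _ := rfl

/-- An element of I_i kills the quotient S_i, so x w has no component in S_i and lies in V. -/
theorem totalMap_extInl_extFst {x : DPA lam} (hx : x ∈ trivialIdeal lam i h0)
    (w : (V.extension h0 m).total) :
    totalMap (V.extInl h0 m) (V.extFst h0 m (x • w)) = x • w := by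
  have h : totalMap (V.extSnd h0 m) (x • w) = 0 := by
    rw [map_smul]
    exact LinearMap.congr_fun ((mem_trivialIdeal lam i h0).1 hx) _
  funext j
  exact Prod.ext rfl (congrFun h j).symm

theorem extFst_extInl (v : V.total) : V.extFst h0 m (totalMap (V.extInl h0 m) v) = v := rfl

/-- The homomorphism from the ideal `I_i` to `V` attached to an element of `Ker π`. -/
def extHom : trivialIdeal lam i h0 →ₗ[DPA lam] V.total where
  toFun x := V.extFst h0 m (x.1 • V.extGen h0 m)
  map_add' x y := by rw [Submodule.coe_add, add_smul, map_add]
  map_smul' a x := by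
    -- The first projection need not commute with the arrows. Linearity is obtained by writing x s
    -- as the image of an element of V under the linear inclusion.
    rw [Submodule.coe_smul, smul_assoc, ← V.totalMap_extInl_extFst h0 m x.2, ← map_smul,
      extFst_extInl, extFst_extInl, RingHom.id_apply]

theorem extHom_apply (x : trivialIdeal lam i h0) :
    V.extHom h0 m x = V.extFst h0 m (x.1 • V.extGen h0 m) := rfl

/-- By construction a* sends the generator (0, 1) to (m_a, 0). Hence evaluation on the arrows
leaving `i` gives back m. -/
theorem extHom_arr {j : I} (a : DArrow j i) :
    V.extHom h0 m ⟨DPA.arr lam a.star, arr_mem_trivialIdeal lam i h0 _⟩ =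
      V.incl j (V.prj a m.1) := by
  rw [extHom_apply]
  dsimp only
  rw [arr_smul, extGen, incl_self_apply]
  have h : (V.extension h0 m).map a.star (V.extGenAt h0 m) =
      (V.extInl h0 m).app j (V.prj a m.1) := by
    refine Prod.ext ?_ rfl
    change V.map a.star 0 + V.extArrow h0 m a.star ((simpleAt lam i h0).symm 1) = V.prj a m.1
    rw [map_zero, zero_add, extArrow_self, LinearEquiv.apply_symm_apply, one_smul, star_star]
  rw [h]
  funext k
  exact congrArg Prod.fst (incl_app (V.extInl h0 m) j k (V.prj a m.1)).symm

/-- The lifted generator is concentrated at `i`, hence fixed by e_i; so the homomorphism lies in e_i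
Hom(I_i, V). -/
theorem extHom_mul_e (x : trivialIdeal lam i h0) :
    V.extHom h0 m (rmul _ (DPA.e lam i) x) = V.extHom h0 m x := by
  have h : DPA.e lam i • V.extGen h0 m = V.extGen h0 m := by
    rw [e_smul, extGen, incl_self_apply]
  rw [extHom_apply, extHom_apply]
  change V.extFst h0 m ((x.1 * DPA.e lam i) • V.extGen h0 m) = _
  rw [mul_smul, h]

end extension

end Rep

/-! ### Hom(I_i, -) is K_i when λ_i = 0 -/

section IdealHomFunctor
open scoped ModuleCat

variable {lam : I → K} {i : I}

/-- The map from the space of the representation `(e_j M)_j` to `M`. -/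
def sumPartsLin (M : ModuleCat.{u} (DPA lam)) : (modToRepObj M).total →ₗ[K] M :=
  ∑ j, (part M j).subtype ∘ₗ ((modToRepObj M).proj j : _ →ₗ[K] part M j)

theorem sumPartsLin_apply (M : ModuleCat.{u} (DPA lam)) (v : (modToRepObj M).total) :
    sumPartsLin M v = ∑ k, ((modToRepObj M).proj k v : part M k).1 :=
  LinearMap.sum_apply _ _ _

theorem sumPartsLin_incl (M : ModuleCat.{u} (DPA lam)) (j : I) (x : part M j) :
    sumPartsLin M ((modToRepObj M).incl j x) = x.1 := by
  rw [sumPartsLin_apply, Finset.sum_eq_single j]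
  · exact congrArg Subtype.val ((modToRepObj M).incl_self_apply j x)
  · intro k _ hk
    exact congrArg Subtype.val ((modToRepObj M).incl_ne_apply hk x)
  · simp

theorem e_smul_sumPartsLin (M : ModuleCat.{u} (DPA lam)) (j : I) (v : (modToRepObj M).total) :
    DPA.e lam j • sumPartsLin M v = ((modToRepObj M).proj j v : part M j).1 := by
  rw [sumPartsLin_apply, Finset.smul_sum, Finset.sum_eq_single j]
  · exact mem_part.1 ((modToRepObj M).proj j v : part M j).2
  · intro k _ hk
    rw [← mem_part.1 ((modToRepObj M).proj k v : part M k).2, ← mul_smul,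
      DPA.e_mul_e_of_ne lam hk.symm, zero_smul]
  · simp

/-- The homomorphism from the module of the representation `(e_j M)_j` to `M`. -/
def sumParts (M : ModuleCat.{u} (DPA lam)) : (modToRepObj M).total →ₗ[DPA lam] M :=
  { sumPartsLin M with
    map_smul' := linear_of_gen (sumPartsLin M)
      (fun j v => by
        rw [Rep.e_smul, e_smul_sumPartsLin]
        exact sumPartsLin_incl M j _)
      (fun {j k} a v => by
        rw [Rep.arr_smul, ← DPA.arr_mul_e, mul_smul, e_smul_sumPartsLin]
        exact sumPartsLin_incl M k _) }

theorem sumParts_incl (M : ModuleCat.{u} (DPA lam)) (j : I) (x : part M j) :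
    sumParts M ((modToRepObj M).incl j x) = x.1 := sumPartsLin_incl M j x

section eval
variable (J : Ideal (DPA lam)) [J.IsTwoSided] (M : ModuleCat.{u} (DPA lam))

/-- Evaluation at an element of the ideal. -/
def evalAt (x : J) : (homFunctor J).obj M →ₗ[K] M where
  toFun φ := IdealHom.lin (M := M) φ x
  map_add' _ _ := rfl
  map_smul' c φ := by
    change IdealHom.lin (M := M) φ (rmul J (algebraMap K _ c) x) =
      algebraMap K (DPA lam) c • IdealHom.lin (M := M) φ x
    rw [← map_smul]
    -- Scalars act on Hom(J, M) through right multiplication on J, which agrees with left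
    -- multiplication because K is central.
    exact congrArg _ (Subtype.ext (Algebra.commutes c x.1).symm)

variable {J M}

/-- The product enters as a separate element z of the ideal, so that no particular proof of
membership is built in; the same form is used in `evalAt_smul` and `evalAt_part`. -/
theorem evalAt_mul (φ : (homFunctor J).obj M) (y : DPA lam) (x z : J) (h : z.1 = y * x.1) :
    evalAt J M z φ = y • evalAt J M x φ := by
  obtain rfl : z = y • x := Subtype.ext h
  exact map_smul (IdealHom.lin (M := M) φ) y x

theorem evalAt_smul (φ : (homFunctor J).obj M) (y : DPA lam) (x z : J) (h : z.1 = x.1 * y) :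
    evalAt J M x (y • φ) = evalAt J M z φ := by
  obtain rfl : z = rmul J y x := Subtype.ext h
  rfl

theorem hom_ext_evalAt {φ ψ : (homFunctor J).obj M}
    (h : ∀ x, evalAt J M x φ = evalAt J M x ψ) : φ = ψ :=
  LinearMap.ext h

/-- Evaluation at an element `x = e_k x` of the ideal, as a map to `e_k M`. -/
def evalPart (x : J) {k : I} (hx : DPA.e lam k * x.1 = x.1) (j : I) :
    part ((homFunctor J).obj M) j →ₗ[K] part M k :=
  (evalAt J M x ∘ₗ (part ((homFunctor J).obj M) j).subtype).codRestrict (part M k) fun φ => by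
    rw [mem_part]
    exact (evalAt_mul φ.1 _ x x hx.symm).symm

/-- The identity φ = e_j φ means φ(x) = φ(x e_j). -/
theorem evalAt_part {j : I} (φ : part ((homFunctor J).obj M) j) (x z : J)
    (h : z.1 = x.1 * DPA.e lam j) : evalAt J M x φ.1 = evalAt J M z φ.1 := by
  rw [← evalAt_smul φ.1 _ x z h, mem_part.1 φ.2]

end eval

variable (h0 : lam i = 0) (M : ModuleCat.{u} (DPA lam))

/-- The arrows as elements of the ideal `I_i`. -/
def idealArr (h0 : lam i = 0) {j k : I} (a : DArrow j k) : trivialIdeal lam i h0 :=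
  ⟨DPA.arr lam a, arr_mem_trivialIdeal lam i h0 a⟩

/-- The idempotents `e_j` with `j ≠ i` as elements of the ideal `I_i`. -/
def idealE (h0 : lam i = 0) {j : I} (hj : j ≠ i) : trivialIdeal lam i h0 :=
  ⟨DPA.e lam j, e_mem_trivialIdeal lam i h0 hj⟩

/-- The family `(φ(a*))_a` of a homomorphism `φ ∈ e_i Hom(I_i, M)`. -/
def evalStar : part ((homFunctor (trivialIdeal lam i h0)).obj M) i →ₗ[K] (modToRepObj M).Oplus i :=
  LinearMap.pi fun a => evalPart (idealArr h0 a.2.star) (DPA.e_mul_arr lam a.2.star) i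

theorem pi_coe (x : (modToRepObj M).Oplus i) : ((modToRepObj M).pi i x : part M i).1 =
    ∑ j : I, ∑ a : DArrow j i, eps K a • DPA.arr lam a • (x ⟨j, a⟩ : part M j).1 := by
  rw [Rep.pi_apply]
  have h := map_sum (part M i).subtype (fun j : I => ∑ a : DArrow j i,
    eps K a • partMap M a (x ⟨j, a⟩)) Finset.univ
  refine h.trans (Finset.sum_congr rfl fun j _ => ?_)
  exact map_sum (part M i).subtype (fun a : DArrow j i => eps K a • partMap M a (x ⟨j, a⟩)) _

/-- By linearity the sum is ψ(∑ ε(a) a a*), and the relation at `i` makes the argument λ_i e_i = 0.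
Hence the values on the arrows leaving `i` form an element of Ker π. -/
theorem sum_arr_smul_apply (ψ : trivialIdeal lam i h0 →ₗ[DPA lam] M) :
    ∑ j : I, ∑ a : DArrow j i, eps K a • DPA.arr lam a • ψ (idealArr h0 a.star) = 0 := by
  have h : ∀ (j : I) (a : DArrow j i), eps K a • DPA.arr lam a • ψ (idealArr h0 a.star) =
      ψ ((eps K a • DPA.arr lam a) • idealArr h0 a.star) := fun j a => by
    rw [← smul_assoc, map_smul]
  simp only [h, ← map_sum]
  rw [← map_zero ψ]
  refine congrArg ψ (Subtype.ext ?_)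
  have h := DPA.relation_at lam i
  rw [h0, zero_smul] at h
  refine Eq.trans ?_ h
  simp only [AddSubmonoidClass.coe_finsetSum, Submodule.coe_smul, smul_eq_mul, smul_mul_assoc]
  rfl

theorem pi_evalStar (φ : part ((homFunctor (trivialIdeal lam i h0)).obj M) i) :
    (modToRepObj M).pi i (evalStar h0 M φ) = 0 :=
  Subtype.ext ((pi_coe M _).trans (sum_arr_smul_apply h0 M (IdealHom.lin (M := M) φ.1)))

/-- For each arrow a : j → i one has (a x_a)(b*) = x_a(b* a) = b* a x_a(e_j), with e_j ∈ I_i because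
j ≠ i. As λ_i = 0, the map γ of K_i is μπ, so this is the compatibility of `homToKer` with π. -/
theorem evalStar_pi (hi : LoopFree i)
    (x : (modToRepObj ((homFunctor (trivialIdeal lam i h0)).obj M)).Oplus i)
    (y : (modToRepObj M).Oplus i)
    (hy : ∀ a : (Σ j : I, DArrow j i), (y a : part M a.1).1 = evalAt _ M (idealE h0 (hi.ne a.2))
      (x a : part ((homFunctor (trivialIdeal lam i h0)).obj M) a.1).1) :
    evalStar h0 M ((modToRepObj ((homFunctor (trivialIdeal lam i h0)).obj M)).pi i x) =
      (modToRepObj M).mu i ((modToRepObj M).pi i y) := by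
  funext ⟨k, b⟩
  refine Eq.trans ?_ ((modToRepObj M).prj_mu_apply b _).symm
  refine Subtype.ext ?_
  refine Eq.trans ?_ (congrArg (DPA.arr lam b.star • ·) (pi_coe M y)).symm
  refine (congrArg (evalAt _ M (idealArr h0 b.star)) (pi_coe _ x)).trans ?_
  simp only [map_sum, map_smul, Finset.smul_sum]
  refine Finset.sum_congr rfl fun j _ => Finset.sum_congr rfl fun a _ => ?_
  rw [smul_comm (DPA.arr lam b.star) (eps K a), hy ⟨j, a⟩, ← mul_smul]
  refine congrArg (eps K a • ·) ?_
  have hmem : DPA.arr lam b.star * DPA.arr lam a ∈ trivialIdeal lam i h0 :=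
    Ideal.mul_mem_left _ _ (arr_mem_trivialIdeal lam i h0 a)
  refine (evalAt_smul _ _ (idealArr h0 b.star) ⟨_, hmem⟩ rfl).trans ?_
  refine evalAt_mul _ _ (idealE h0 (hi.ne a)) ⟨_, hmem⟩ ?_
  change _ = DPA.arr lam b.star * DPA.arr lam a * DPA.e lam j
  rw [mul_assoc, DPA.arr_mul_e]

variable (hi : LoopFree i) (hlam : lam = reflWeight i lam)

/-- The natural morphism of representations from `Hom(I_i, M)` to `K_i(M)`. -/
def homToKer : (modToRep lam).obj ((homFunctor (trivialIdeal lam i h0)).obj M) ⟶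
    (Rep.kerRefl hi hlam).obj ((modToRep lam).obj M) :=
  Rep.homMk hi
    (((modToRepObj M).kerAt hi hlam).symm.toLinearMap ∘ₗ
      (evalStar h0 M).codRestrict (LinearMap.ker ((modToRepObj M).pi i)) (pi_evalStar h0 M))
    (fun j hj => ((modToRepObj M).kerNe hi hlam j hj).symm.toLinearMap ∘ₗ
      (evalPart (idealE h0 hj) (DPA.e_mul_e lam j) j :
        part ((homFunctor (trivialIdeal lam i h0)).obj M) j →ₗ[K] part M j))
    (fun j k hj hk a φ => by
      refine ((modToRepObj M).kerNe hi hlam k hk).injective ?_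
      refine (LinearEquiv.apply_symm_apply _ _).trans ?_
      refine Eq.trans ?_ ((modToRepObj M).kerNe_map hi hlam hj hk a _).symm
      refine Eq.trans ?_ (congrArg _ (LinearEquiv.apply_symm_apply _ _).symm)
      refine Subtype.ext ?_
      -- Both sides equal φ(a): (aφ)(e_k) = φ(e_k a) = φ(a) = φ(a e_j) = a φ(e_j).
      refine (evalAt_smul _ (DPA.arr lam a) (idealE h0 hk) (idealArr h0 a)
        (DPA.e_mul_arr lam a).symm).trans ?_
      exact evalAt_mul _ (DPA.arr lam a) (idealE h0 hj) (idealArr h0 a) (DPA.arr_mul_e lam a).symm)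
    (fun φ => by
      refine ((modToRepObj M).kerOplus hi hlam).injective ?_
      refine ((modToRepObj M).kerOplus_mu hi hlam _).trans ?_
      refine (congrArg Subtype.val (LinearEquiv.apply_symm_apply _ _)).trans ?_
      funext ⟨j, a⟩
      refine Eq.trans ?_ (LinearEquiv.apply_symm_apply _ _).symm
      refine Subtype.ext ?_
      refine (evalAt_smul _ (DPA.arr lam a.star) (idealE h0 (hi.ne a)) (idealArr h0 a.star)
        (DPA.e_mul_arr lam a.star).symm).symm.trans ?_
      refine congrArg (evalAt _ M (idealE h0 (hi.ne a))) ?_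
      exact congrArg Subtype.val (Rep.prj_mu_apply _ a φ).symm)
    (fun x => by
      refine ((modToRepObj M).kerAt hi hlam).injective ?_
      refine (LinearEquiv.apply_symm_apply _ _).trans ?_
      refine Eq.trans ?_ ((modToRepObj M).kerAt_pi hi hlam _).symm
      refine Subtype.ext ?_
      refine (evalStar_pi h0 M hi x _ fun a => ?_).trans
        (((modToRepObj M).kerGamma_coe _).trans (by rw [h0, zero_smul, sub_zero])).symm
      exact congrArg Subtype.val (LinearEquiv.apply_symm_apply _ _))

theorem kerNe_homToKer {j : I} (hj : j ≠ i)
    (φ : part ((homFunctor (trivialIdeal lam i h0)).obj M) j) :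
    (modToRepObj M).kerNe hi hlam j hj ((homToKer h0 M hi hlam).app j φ) =
      evalPart (M := M) (idealE h0 hj) (DPA.e_mul_e lam j) j φ := by
  refine (congrArg ((modToRepObj M).kerNe hi hlam j hj)
    (LinearMap.congr_fun (Rep.homMk_app_of_ne (V := (modToRep lam).obj
      ((homFunctor (trivialIdeal lam i h0)).obj M))
      hi _ _ _ _ _ hj) φ)).trans ?_
  exact LinearEquiv.apply_symm_apply _ _

theorem kerAt_homToKer (φ : part ((homFunctor (trivialIdeal lam i h0)).obj M) i) :
    ((modToRepObj M).kerAt hi hlam ((homToKer h0 M hi hlam).app i φ)).1 = evalStar h0 M φ := by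
  refine (congrArg (fun x => ((modToRepObj M).kerAt hi hlam x).1)
    (LinearMap.congr_fun (Rep.homMk_app_self (V := (modToRep lam).obj
      ((homFunctor (trivialIdeal lam i h0)).obj M))
      hi _ _ _ _ _) φ)).trans ?_
  exact congrArg Subtype.val (LinearEquiv.apply_symm_apply _ _)

/-- As e_j ∈ I_i, a homomorphism φ = e_j φ satisfies φ(x) = φ(x e_j) = x φ(e_j); conversely m ∈ e_j
M gives x ↦ x m. -/
theorem evalPart_bijective {j : I} (hj : j ≠ i) :
    Function.Bijective (evalPart (M := M) (idealE h0 hj) (DPA.e_mul_e lam j) j) := by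
  constructor
  · intro φ ψ h
    have h' : evalAt _ M (idealE h0 hj) φ.1 = evalAt _ M (idealE h0 hj) ψ.1 :=
      congrArg Subtype.val h
    refine Subtype.ext (hom_ext_evalAt fun x => ?_)
    have hx := Ideal.mul_mem_right (DPA.e lam j) _ x.2
    rw [evalAt_part φ x ⟨_, hx⟩ rfl, evalAt_part ψ x ⟨_, hx⟩ rfl,
      evalAt_mul φ.1 x.1 (idealE h0 hj) ⟨_, hx⟩ rfl, evalAt_mul ψ.1 x.1 (idealE h0 hj) ⟨_, hx⟩ rfl,
      h']
  · intro m
    let φ : trivialIdeal lam i h0 →ₗ[DPA lam] M :=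
      (LinearMap.toSpanSingleton (DPA lam) M m.1).comp (Submodule.subtype _)
    refine ⟨⟨φ, mem_part.2 (LinearMap.ext fun x => ?_)⟩, Subtype.ext (mem_part.1 m.2)⟩
    change (x.1 * DPA.e lam j) • m.1 = x.1 • m.1
    rw [mul_smul, mem_part.1 m.2]

/-- For φ = e_i φ one has φ(x) = φ(x e_i), and x e_i is a left combination of the arrows leaving
`i`. -/
theorem evalStar_injective : Function.Injective (evalStar h0 M) := by
  intro φ ψ h
  refine Subtype.ext (hom_ext_evalAt fun x => ?_)
  obtain ⟨y, hy⟩ := exists_mul_e_eq_of_mem lam i h0 x.2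
  let z : trivialIdeal lam i h0 := ∑ b : (Σ j : I, DArrow j i), y b • idealArr h0 b.2.star
  have hz : z.1 = x.1 * DPA.e lam i := by
    rw [hy]
    exact AddSubmonoidClass.coe_finsetSum _ _
  have hsum : ∀ χ : part ((homFunctor (trivialIdeal lam i h0)).obj M) i,
      evalAt _ M z χ.1 = ∑ b, y b • (evalStar h0 M χ b : part M b.1).1 := by
    intro χ
    refine (map_sum (IdealHom.lin (M := M) χ.1) _ _).trans (Finset.sum_congr rfl fun b _ => ?_)
    exact map_smul (IdealHom.lin (M := M) χ.1) (y b) _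
  rw [evalAt_part φ x z hz, evalAt_part ψ x z hz, hsum, hsum, h]

/-- The content is that ∑ ε(a) a a* = 0 generates the relations among the generators a* of I_i e_i.
No presentation is computed: the extension of S_i attached to m provides the homomorphism. -/
theorem exists_evalStar_eq (m : (modToRepObj M).Ker i) : ∃ φ, evalStar h0 M φ = m.1 := by
  let φ : trivialIdeal lam i h0 →ₗ[DPA lam] M := sumParts M ∘ₗ (modToRepObj M).extHom h0 m
  refine ⟨⟨φ, mem_part.2 (LinearMap.ext fun x => ?_)⟩, funext fun a => Subtype.ext ?_⟩
  · exact congrArg (sumParts M) ((modToRepObj M).extHom_mul_e h0 m x)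
  · exact (congrArg (sumParts M) ((modToRepObj M).extHom_arr h0 m a.2)).trans
      (sumParts_incl M _ _)

theorem isIso_homToKer : IsIso (homToKer h0 M hi hlam) := by
  refine Rep.isIso_of_bijective _ fun j => ?_
  by_cases hj : j = i
  · subst hj
    constructor
    · intro φ ψ h
      refine evalStar_injective h0 M ?_
      refine (kerAt_homToKer h0 M hi hlam φ).symm.trans ?_
      refine Eq.trans ?_ (kerAt_homToKer h0 M hi hlam ψ)
      exact congrArg (fun x => ((modToRepObj M).kerAt hi hlam x).1) h
    · intro x
      obtain ⟨φ, hφ⟩ := exists_evalStar_eq h0 M ((modToRepObj M).kerAt hi hlam x)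
      refine ⟨φ, ((modToRepObj M).kerAt hi hlam).injective (Subtype.ext ?_)⟩
      rw [← hφ]
      exact kerAt_homToKer h0 M hi hlam φ
  · have h := evalPart_bijective h0 M hj
    have h' : ⇑(evalPart (M := M) (idealE h0 hj) (DPA.e_mul_e lam j) j) =
        (modToRepObj M).kerNe hi hlam j hj ∘ (homToKer h0 M hi hlam).app j :=
      funext fun φ => (kerNe_homToKer h0 M hi hlam hj φ).symm
    rw [h'] at h
    exact (Function.Bijective.of_comp_iff' (LinearEquiv.bijective _) _).1 h

/-- `Hom(I_i, -)` is `K_i` on representations, if `λ_i = 0`. -/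
def homFunctorIso : homFunctor (trivialIdeal lam i h0) ⋙ modToRep lam ≅
    modToRep lam ⋙ Rep.kerRefl hi hlam :=
  haveI := fun M => isIso_homToKer h0 M hi hlam
  NatIso.ofComponents (fun M => asIso (homToKer h0 M hi hlam)) fun {M N} f => by
    refine Rep.hom_ext_of_mu_injective hi (Rep.mu_kerRefl_injective _ hi hlam) fun j hj =>
      LinearMap.ext fun φ => (Rep.kerNe _ hi hlam j hj).injective ?_
    refine (kerNe_homToKer h0 N hi hlam hj _).trans ?_
    refine Eq.trans ?_ (Rep.kerNe_kerRefl_map hi hlam ((modToRep lam).map f) j hj _).symm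
    exact congrArg (homPart f j) (kerNe_homToKer h0 M hi hlam hj φ).symm

/-- `K_i ≅ Hom(I_i, -)` if `λ_i = 0`. -/
def kerFunctorIsoHom : kerFunctor hi hlam ≅ homFunctor (trivialIdeal lam i h0) :=
  Functor.isoWhiskerRight (homFunctorIso h0 hi hlam).symm (modToRep lam).inv ≪≫
    Functor.isoWhiskerLeft (homFunctor (trivialIdeal lam i h0))
      (modToRep lam).asEquivalence.unitIso.symm

/-- `C_i ≅ I_i ⊗ -` if `λ_i = 0`. -/
def cokerFunctorIsoTensor : cokerFunctor hi hlam ≅ tensorFunctor (trivialIdeal lam i h0) :=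
  -- Both functors are left adjoint to Hom(I_i, -), and left adjoints are unique up to isomorphism.
  ((cokerKerFunctorAdjunction hi hlam hlam).ofNatIsoRight
    (kerFunctorIsoHom h0 hi hlam)).leftAdjointUniq (tensorHomAdjunction _)

end IdealHomFunctor

end DeformedPreprojective

end ReflectionFunctors

/-! ### The theorem on reflection functors -/

theorem theorem1p2 {K : Type u} [Field K] {I : Type u} [Quiver.{u} I] [Fintype I] [DecidableEq I]
    [∀ i j : I, Fintype (i ⟶ j)] (lam : I → K) (i : I) (hi : LoopFree i) :
    Nonempty (cokerFunctor (lam := lam) (lam' := reflWeight i lam) hi rfl ⊣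
      kerFunctor (lam := reflWeight i lam) (lam' := lam) hi (reflWeight_reflWeight hi lam).symm) ∧
    (∀ h0 : lam i ≠ 0,
      Nonempty (cokerFunctor (lam := lam) (lam' := reflWeight i lam) hi rfl ≅
        kerFunctor (lam := lam) (lam' := reflWeight i lam) hi rfl) ∧
      Nonempty (kerFunctor (lam := lam) (lam' := reflWeight i lam) hi rfl ≅
        cbhFunctor (lam := lam) (lam' := reflWeight i lam) hi rfl h0) ∧
      (cokerFunctor (lam := lam) (lam' := reflWeight i lam) hi rfl).IsEquivalence ∧
      Nonempty (cokerFunctor (lam := lam) (lam' := reflWeight i lam) hi rfl ⋙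
          cokerFunctor (lam := reflWeight i lam) (lam' := lam) hi
            (reflWeight_reflWeight hi lam).symm ≅
        𝟭 (ModuleCat.{u} (DPA lam)))) ∧
    (∀ h0 : lam i = 0,
      Nonempty (cokerFunctor (lam := lam) (lam' := lam) hi (reflWeight_eq_self h0).symm ≅
        tensorFunctor (trivialIdeal lam i h0)) ∧
      Nonempty (kerFunctor (lam := lam) (lam' := lam) hi (reflWeight_eq_self h0).symm ≅
        homFunctor (trivialIdeal lam i h0))) := by
  have hrefl := (reflWeight_reflWeight hi lam).symm
  refine ⟨⟨cokerKerFunctorAdjunction hi rfl hrefl⟩, fun h0 => ⟨⟨?_⟩, ⟨?_⟩, ?_, ⟨?_⟩⟩,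
    fun h0 => ⟨⟨cokerFunctorIsoTensor h0 hi _⟩, ⟨kerFunctorIsoHom h0 hi _⟩⟩⟩
  · exact Functor.isoWhiskerLeft (modToRep lam)
      (Functor.isoWhiskerRight (Rep.cokerReflIsoKerRefl hi rfl h0) _)
  · exact Functor.isoWhiskerLeft (modToRep lam)
      (Functor.isoWhiskerRight (Rep.kerReflIsoCbhRefl hi rfl h0) _)
  · exact isEquivalence_cokerFunctor hi rfl hrefl h0
  · exact cokerFunctorCompIso hi rfl hrefl h0
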